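/- **The algorithm.** Quicksort on the fly acts on a finite set $S$ of distinct reals. If $|S|\le 1$, its element (if any) is returned at once, without comparisons. If $|S|\ge 2$, a pivot is chosen uniformly from $S$ (independently of all other choices), the other $|S|-1$ elements are compared with it, which costs $|S|-1$ comparisons; then the set $S_<$ of smaller elements is processed, the pivot is returned, and the set $S_>$ of larger elements is processed, recursively. So the elements are returned in increasing order. For $|S|=n$ let $X(n,l)$, $1\le l\le n$, be the number of comparisons made until the $l$-th smallest element of $S$ is returned, and $X(n,0)=0$; the law of $(X(n,l))_{0\le l\le n}$ depends on $S$ only through $n$. For $n\ge 1$ and $t\in[0,1]$ put $$Y_n(t)=\frac{X(n,\lfloor nt\rfloor)-E\,X(n,\lfloor nt\rfloor)}{n}.$$ **The Quicksort process.** Let $V=\{1,2\}^*$ be the set of finite words over $\{1,2\}$, with the empty word $\emptyset$ and word length $|w|$, and let $U^v$, $v\in V$, be independent random variables uniform on $[0,1]$. With $0\ln 0=0$ put $$C(x)=1+2x\ln x+2(1-x)\ln(1-x),$$ $$C(t,x)=C(x)+2\cdot 1_{t<x}\bigl(-1+x+(1-t)\ln(1-t)-(1-x)\ln(1-x)-(x-t)\ln(x-t)\bigr).$$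 For $v\in V$ define $\ell^v_\emptyset=1$, $\ell^v_{w1}=\ell^v_w U^{vw}$, $\ell^v_{w2}=\ell^v_w(1-U^{vw})$ and $$Q^v=\lim_{m\to\infty}\sum_{|w|<m}\ell^v_w\,C(U^{vw}).$$ For $t\in[0,1]$ let $$A_1^v(t)=1_{t<U^v}U^v,\quad B_1^v(t)=1\wedge\tfrac{t}{U^v},\quad A_2^v(t)=1_{t\ge U^v}(1-U^v),\quad B_2^v(t)=0\vee\tfrac{t-U^v}{1-U^v},$$ $$C^v(t)=C(t,U^v)+1_{t\ge U^v}U^vQ^{v1},$$ and define along words $A_\emptyset=1$, $B_\emptyset=\mathrm{id}$, $A_{wi}(t)=A_w(t)\,A_i^w(B_w(t))$, $B_{wi}(t)=B_i^w(B_w(t))$, and $$R_m(t)=\sum_{|w|<m}A_w(t)\,C^w(B_w(t)),\qquad Y(t)=\lim_{m\to\infty}R_m(t).$$ **Theorem.** Almost surely, the limits $Q^v$ exist for all $v\in V$ and $R_m$ converges uniformly on $[0,1]$ to $Y$, so that the Quicksort process $Y$ is well defined. For all $k\in\mathbb N$ and $t_1,\dots,t_k\in(0,1]$, $$(Y_n(t_1),\dots,Y_n(t_k))\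 \longrightarrow\ (Y(t_1),\dots,Y(t_k))\quad\text{in distribution as } n\to\infty .$$ -/

import Mathlib

open MeasureTheory ProbabilityTheory Filter Topology

noncomputable section

/-! ## The algorithm Quicksort on the fly -/

/-- Quicksort on the fly, run on a finite set `S` of distinct reals, with internal randomness and
with a counter `c` of the comparisons made so far. A list with at most one element needs no
comparison; its element is returned at once. Otherwise a pivot `p` is chosen uniformly from `S`,
the remaining `|S| - 1` elements are compared with it, the list `S_<` of smaller elements is
processed, `p` is returned, and the list `S_>` of larger elements is processed.
The result is the output stream (each returned element together with the value of the counter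
when it is returned, in the order of the output) and the final value of the counter. All random
choices are independent. -/
def quicksortOnTheFly (S : Finset ℝ) (c : ℕ) : PMF (List (ℝ × ℕ) × ℕ) :=
  if h : S.card ≤ 1 then PMF.pure (S.toList.map (fun x => (x, c)), c)
  else
    haveI : Nonempty S :=
      (Finset.card_pos.mp (lt_trans Nat.zero_lt_one (not_le.mp h))).to_subtype
    (PMF.uniformOfFintype S).bind fun p =>
      (quicksortOnTheFly (S.filter (fun x => x < (p : ℝ))) (c + (S.card - 1))).bind fun left =>
        (quicksortOnTheFly (S.filter (fun x => (p : ℝ) < x)) left.2).bind fun right =>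
          PMF.pure (left.1 ++ ((p : ℝ), left.2) :: right.1, right.2)
termination_by S.card
decreasing_by
  all_goals
    exact Finset.card_lt_card
      (Finset.filter_ssubset.mpr ⟨(p : ℝ), p.2, lt_irrefl _⟩)

/-- The law of the process `l ↦ X(S, l)`, where `X(S, l)` for `1 ≤ l ≤ |S|` is the number of
comparisons made until the `l`-th smallest element of `S`, which is the `l`-th element of the
output, is returned, and `X(S, 0) = 0`. (Beyond `l = |S|` the value is `0`; it is not used.) -/
def runningTimeLaw (S : Finset ℝ) : PMF (ℕ → ℕ) :=
  (quicksortOnTheFly S 0).map fun r l => (0 :: r.1.map Prod.snd).getD l 0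

/-- The normalised running time `Y_n(t) = (X(n, ⌊nt⌋) - E X(n, ⌊nt⌋)) / n`. -/
def normalizedRunningTime {Ω : Type*} [MeasurableSpace Ω] (P : Measure Ω) (X : Ω → ℕ → ℕ)
    (n : ℕ) (t : ℝ) (ω : Ω) : ℝ :=
  ((X ω ⌊(n : ℝ) * t⌋₊ : ℝ) - ∫ ω', (X ω' ⌊(n : ℝ) * t⌋₊ : ℝ) ∂P) / n

/-! ## The Quicksort process

The vertices of the binary tree are the finite words over a two letter alphabet, written as lists
with the last letter first. The letter `false` is the first child ("left") and `true` the second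
child ("right"): the children of `v` are `false :: v` and `true :: v`, the root is `[]`, and the
vertex reached from `v` along the path `w` is `w ++ v`. -/

namespace QuicksortProcess

/-- The cost function `C(x) = 1 + 2 x ln x + 2 (1 - x) ln (1 - x)`, with `0 ln 0 = 0`. -/
def cost (x : ℝ) : ℝ := 1 + 2 * (x * Real.log x) + 2 * ((1 - x) * Real.log (1 - x))

/-- The cost function `C(t, x)`. -/
def costAt (t x : ℝ) : ℝ :=
  cost x + if t < x then
    2 * (-1 + x + (1 - t) * Real.log (1 - t) - (1 - x) * Real.log (1 - x)
      - (x - t) * Real.log (x - t)) else 0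

/-- The sum of `f w` over all words `w` of length less than `m`. -/
def sumWords (m : ℕ) (f : List Bool → ℝ) : ℝ :=
  ∑ k ∈ Finset.range m, ∑ w : Fin k → Bool, f (List.ofFn w)

section Paths

/-! In this section `u v` is the value, for one outcome, of the uniform random variable attached
to the vertex `v`. -/

variable (u : List Bool → ℝ)

/-- The weight of the edge from `v` to its child `i`: the value `u v` for the first child and
`1 - u v` for the second one. -/
def edge (v : List Bool) (i : Bool) : ℝ := if i then 1 - u v else u v

/-- The product of the edge weights along the path `w` that starts at the vertex `v`. -/
def pathWeight (v : List Bool) : List Bool → ℝ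
  | [] => 1
  | i :: w => pathWeight v w * edge u (w ++ v) i

/-- The total weighted cost of the first `m` generations below `v`. -/
def partialTotal (m : ℕ) (v : List Bool) : ℝ :=
  sumWords m fun w => pathWeight u v w * cost (u (w ++ v))

/-- The random variable `Q^v`, the limit of the total weighted costs below `v`. -/
def total (v : List Bool) : ℝ := limUnder atTop fun m => partialTotal u m v

/-- The space transformation `A_i^v` on the edge from `v` to its child `i`: the function
`u 1_{[0,u)}` for the first child and `(1 - u) 1_{[u,1]}` for the second, where `u = u v`. -/
def edgeSpace (v : List Bool) (i : Bool) (t : ℝ) : ℝ :=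
  if i then (if u v ≤ t then 1 - u v else 0) else (if t < u v then u v else 0)

/-- The time transformation `B_i^v` on the edge from `v` to its child `i`: the function
`1 ∧ t / u` for the first child and `0 ∨ (t - u) / (1 - u)` for the second, where `u = u v`. -/
def edgeTime (v : List Bool) (i : Bool) (t : ℝ) : ℝ :=
  if i then max 0 ((t - u v) / (1 - u v)) else min 1 (t / u v)

/-- The path weight `L_w = (A_w, B_w)` along the path from the root to `w`: the composition
`L_{wi} = L_w * T_i^w` of the edge transformations `T_i^w = (A_i^w, B_i^w)`, where
`(f₁, g₁) * (f₂, g₂) = (f₁ · (f₂ ∘ g₁), g₂ ∘ g₁)`. -/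
def path : List Bool → (ℝ → ℝ) × (ℝ → ℝ)
  | [] => (fun _ => 1, id)
  | i :: w => (fun t => (path w).1 t * edgeSpace u w i ((path w).2 t),
      edgeTime u w i ∘ (path w).2)

/-- The cost `C^v = C(·, u) + u 1_{[u,1]} Q^{v1}` of the vertex `v`, where `u = u v`. -/
def vertexCost (v : List Bool) (t : ℝ) : ℝ :=
  costAt t (u v) + if u v ≤ t then u v * total u (false :: v) else 0

/-- The sum `R_m(t)` of the terms `(L_w ⊙ C^w)(t) = A_w(t) C^w(B_w(t))` over the first `m`
generations. -/
def partialProcess (m : ℕ) (t : ℝ) : ℝ :=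
  sumWords m fun w => (path u w).1 t * vertexCost u w ((path u w).2 t)

/-- The Quicksort process `Y(t) = lim R_m(t)`. -/
def process (t : ℝ) : ℝ := limUnder atTop fun m => partialProcess u m t

end Paths

end QuicksortProcess

end

/-! All the running times are realised on one probability space, the tree of independent uniform
variables. With `n` elements and the value `x` at the root, the pivot has rank `⌊n x⌋`, and the two
parts are processed with the two subtrees. By `map_node` the root and the subtrees are independent
and the subtrees have the law of the whole tree, so the coupled algorithm has the law of the actual
one (`expect_quicksort`, `runningTimeLaw_toMeasure`). It then suffices to prove convergence in
probability in the coupling.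

Subtracting the explicit means `meanCost` turns the recursion into one with a toll that has mean
zero over the pivot (`sum_toll`) and size `O(n)` (`abs_toll_le`). Every second moment is controlled
by one contraction, `centered_of_split`: given the root, the parts are independent and centred, with
factors `x ^ 2` and `(1 - x) ^ 2`, whose expectations sum to `2 / 3`. Hence cutting the recursion at
depth `m` costs, after division by `n`, a second moment of order `(2 / 3) ^ m`, uniformly in `n`
(`centered_running_sub`).

At a fixed depth `m` the limit is taken pathwise: `toll / n` tends to `costAt` away from the pivot,
and a fixed time almost surely hits no pivot, so the cut running times tend to `trunc m`
(`tendsto_running`). The partial sum `R_m` differs from `trunc m` by `truncError m`, because it uses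
the full `Q` of each completed left part; this error is again of order `(2 / 3) ^ m` in second
moment.

For uniform convergence of `R_m`, each time lies in only one child interval. The squared increment
is therefore bounded, for all times at once, by `majorant m`, whose expectation decays like `(2 / 3)
^ m`. -/

noncomputable section

/-! ## The law of the tree of uniform random variables -/

namespace QuicksortProcess

/-- The uniform distribution on `[0, 1]`. -/
abbrev unif : Measure ℝ := volume.restrict (Set.Icc (0 : ℝ) 1)

instance : IsProbabilityMeasure unif := ⟨by simp⟩

/-- The law of a tree of independent uniform random variables. -/
abbrev treeLaw : Measure (List Bool → ℝ) := Measure.infinitePi fun _ => unif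

/-- The subtree at the `i`-th child of the root. -/
def sub (i : Bool) (u : List Bool → ℝ) : List Bool → ℝ := fun w => u (w ++ [i])

/-- The tree with the value `x.1` at the root and the subtrees `x.2.1` and `x.2.2`. -/
def node (x : ℝ × (List Bool → ℝ) × (List Bool → ℝ)) : List Bool → ℝ := fun w =>
  if w = [] then x.1 else if w.getLast? = some false then x.2.1 w.dropLast else x.2.2 w.dropLast

/-- The decomposition of a tree into the value at the root and two subtrees. -/
def split (u : List Bool → ℝ) : ℝ × (List Bool → ℝ) × (List Bool → ℝ) :=
  (u [], sub false u, sub true u)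

@[simp] lemma node_nil (x : ℝ × (List Bool → ℝ) × (List Bool → ℝ)) : node x [] = x.1 := by
  simp [node]

@[simp] lemma node_append_false (x : ℝ × (List Bool → ℝ) × (List Bool → ℝ)) (w : List Bool) :
    node x (w ++ [false]) = x.2.1 w := by
  simp [node]

@[simp] lemma node_append_true (x : ℝ × (List Bool → ℝ) × (List Bool → ℝ)) (w : List Bool) :
    node x (w ++ [true]) = x.2.2 w := by
  simp [node]

lemma split_node (x : ℝ × (List Bool → ℝ) × (List Bool → ℝ)) : split (node x) = x := by
  refine Prod.ext ?_ (Prod.ext ?_ ?_)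
  · simp [split]
  · funext w
    simp [split, sub]
  · funext w
    simp [split, sub]

@[fun_prop] lemma measurable_sub (i : Bool) : Measurable (sub i) :=
  measurable_pi_lambda _ fun _ => measurable_pi_apply _

@[fun_prop] lemma measurable_split : Measurable split := by
  unfold split
  fun_prop

lemma measurable_node : Measurable node := by
  refine measurable_pi_lambda _ fun w => ?_
  unfold node
  split_ifs <;> fun_prop

/-- A product over a finite set of words, split according to the first letter of the words. -/
lemma prod_words_split (s : Finset (List Bool)) (f : List Bool → ENNReal) :
    ∏ w ∈ s, f w = (if [] ∈ s then f [] else 1) *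
      ((∏ w ∈ s.preimage (· ++ [false]) (List.append_left_injective _).injOn, f (w ++ [false])) *
       ∏ w ∈ s.preimage (· ++ [true]) (List.append_left_injective _).injOn, f (w ++ [true])) := by
  classical
  have key : ∀ i : Bool,
      ∏ w ∈ s.preimage (· ++ [i]) (List.append_left_injective _).injOn, f (w ++ [i])
        = ∏ w ∈ s, if w.getLast? = some i then f w else 1 := by
    intro i
    rw [Finset.prod_preimage' (fun w => w ++ [i]) s _ f, Finset.prod_filter]
    refine Finset.prod_congr rfl fun w _ => ?_
    congr 1
    simp only [Set.mem_range, eq_iff_iff, List.getLast?_eq_some_iff]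
    exact ⟨fun ⟨a, h⟩ => ⟨a, h.symm⟩, fun ⟨a, h⟩ => ⟨a, h.symm⟩⟩
  have h0 : (if [] ∈ s then f [] else 1) = ∏ w ∈ s, if w = [] then f w else 1 := by
    simp
  rw [key, key, h0, ← Finset.prod_mul_distrib, ← Finset.prod_mul_distrib]
  refine Finset.prod_congr rfl fun w _ => ?_
  rcases List.eq_nil_or_concat w with rfl | ⟨w, i, rfl⟩
  · simp
  · cases i <;> simp

/-- The branching property of the tree. A product measure is determined by its values on cylinders,
and the preimage of a cylinder is a product of a condition at the root and one cylinder in each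
subtree. -/
lemma map_node : (unif.prod (treeLaw.prod treeLaw)).map node = treeLaw := by
  classical
  refine Measure.eq_infinitePi _ fun s t ht => ?_
  have hpre : node ⁻¹' (Set.pi s t) = (if [] ∈ s then t [] else Set.univ) ×ˢ
      (Set.pi (s.preimage (· ++ [false]) (List.append_left_injective _).injOn)
        (fun w => t (w ++ [false])) ×ˢ
       Set.pi (s.preimage (· ++ [true]) (List.append_left_injective _).injOn)
        (fun w => t (w ++ [true]))) := by
    ext x
    simp only [Set.mem_preimage, Set.mem_pi, Finset.mem_coe, Set.mem_prod, Finset.mem_preimage]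
    constructor
    · intro h
      refine ⟨?_, fun w hw => by simpa using h _ hw, fun w hw => by simpa using h _ hw⟩
      split_ifs with h0
      · simpa using h _ h0
      · trivial
    · rintro ⟨h0, h1, h2⟩ w hw
      rcases List.eq_nil_or_concat w with rfl | ⟨w, i, rfl⟩
      · simpa [hw] using h0
      · cases i
        · simpa using h1 w (by simpa using hw)
        · simpa using h2 w (by simpa using hw)
  rw [Measure.map_apply measurable_node
    (MeasurableSet.pi s.countable_toSet fun w _ => ht w), hpre, Measure.prod_prod,
    Measure.prod_prod, Measure.infinitePi_pi _ (fun w _ => ht _),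
    Measure.infinitePi_pi _ (fun w _ => ht _), prod_words_split s]
  congr 1
  split_ifs <;> simp

lemma measurePreserving_split :
    MeasurePreserving split treeLaw (unif.prod (treeLaw.prod treeLaw)) := by
  refine ⟨measurable_split, ?_⟩
  conv_lhs => rw [← map_node]
  rw [Measure.map_map measurable_split measurable_node]
  have : split ∘ node = id := funext split_node
  rw [this, Measure.map_id]

lemma measurePreserving_sub (i : Bool) : MeasurePreserving (sub i) treeLaw treeLaw := by
  cases i
  · exact (measurePreserving_fst.comp measurePreserving_snd).comp measurePreserving_split
  · exact (measurePreserving_snd.comp measurePreserving_snd).comp measurePreserving_split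

lemma ae_unif_mem : ∀ᵐ x ∂unif, x ∈ Set.Ioo (0 : ℝ) 1 := by
  rw [unif, restrict_Ioo_eq_restrict_Icc.symm]
  exact ae_restrict_mem measurableSet_Ioo

lemma ae_unif_ne (t : ℝ) : ∀ᵐ x ∂unif, x ≠ t :=
  ae_restrict_of_ae (Measure.ae_ne volume t)

/-- The trees with all values in `(0, 1)`. -/
def Inner (u : List Bool → ℝ) : Prop := ∀ w, u w ∈ Set.Ioo (0 : ℝ) 1

lemma Inner.sub {u : List Bool → ℝ} (h : Inner u) (i : Bool) :
    Inner (QuicksortProcess.sub i u) :=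
  fun _ => h _

lemma ae_inner : ∀ᵐ u ∂treeLaw, Inner u := by
  refine ae_all_iff.2 fun w => ?_
  exact (measurePreserving_eval_infinitePi (fun _ : List Bool => unif) w).quasiMeasurePreserving.ae
    ae_unif_mem

/-! ## Centred square integrable functions of a tree -/

/-- The function `f` of a random tree has mean zero and second moment at most `c`. -/
structure Centered (f : (List Bool → ℝ) → ℝ) (c : ℝ) : Prop where
  memLp : MemLp f 2 treeLaw
  mean : ∫ u, f u ∂treeLaw = 0
  moment : ∫ u, f u ^ 2 ∂treeLaw ≤ c

namespace Centered

variable {f g : (List Bool → ℝ) → ℝ} {c d : ℝ}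

lemma zero (hc : 0 ≤ c) : Centered (fun _ => 0) c :=
  ⟨MemLp.zero', by simp, by simpa⟩

lemma mono (h : Centered f c) (hcd : c ≤ d) : Centered f d :=
  ⟨h.memLp, h.mean, h.moment.trans hcd⟩

lemma congr (h : Centered f c) (hfg : f =ᵐ[treeLaw] g) : Centered g c :=
  ⟨h.memLp.ae_eq hfg, by rw [← integral_congr_ae hfg, h.mean],
    (integral_congr_ae (hfg.mono fun u hu => congrArg (· ^ 2) hu)).symm.trans_le h.moment⟩

lemma const_mul (h : Centered f c) (r : ℝ) : Centered (fun u => r * f u) (r ^ 2 * c) :=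
  ⟨h.memLp.const_mul r, by rw [integral_const_mul, h.mean, mul_zero], by
    simp only [mul_pow]
    rw [integral_const_mul]
    exact mul_le_mul_of_nonneg_left h.moment (sq_nonneg r)⟩

lemma integrable (h : Centered f c) : Integrable f treeLaw := h.memLp.integrable (by norm_num)

lemma eLpNorm_le (h : Centered f c) : eLpNorm f 2 treeLaw ≤ ENNReal.ofReal (Real.sqrt c) := by
  rw [h.memLp.eLpNorm_eq_integral_rpow_norm (by norm_num) (by norm_num)]
  refine ENNReal.ofReal_le_ofReal ?_
  rw [Real.sqrt_eq_rpow]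
  norm_num
  exact Real.rpow_le_rpow (integral_nonneg fun u => sq_nonneg _) h.moment (by norm_num)

/-- Chebyshev's inequality. -/
lemma measure_ge_le (h : Centered f c) {ε : ℝ} (hε : 0 < ε) :
    treeLaw {u | ε ≤ |f u|} ≤ ENNReal.ofReal (c / ε ^ 2) := by
  have h1 := mul_meas_ge_le_integral_of_nonneg (μ := treeLaw) (f := fun u => f u ^ 2)
    (ae_of_all _ fun u => sq_nonneg _) h.memLp.integrable_sq (ε ^ 2)
  have h2 : {u | ε ≤ |f u|} = {u | ε ^ 2 ≤ f u ^ 2} := by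
    ext u
    simp only [Set.mem_ofPred_eq]
    rw [← sq_abs (f u)]
    exact (pow_le_pow_iff_left₀ hε.le (abs_nonneg _) two_ne_zero).symm
  rw [h2]
  refine (ENNReal.le_ofReal_iff_toReal_le (measure_ne_top _ _) ?_).2 ?_
  · exact div_nonneg ((integral_nonneg fun u => sq_nonneg _).trans h.moment) (sq_nonneg ε)
  · rw [le_div_iff₀ (by positivity), mul_comm]
    exact h1.trans h.moment

end Centered

/-- The second moment of a sum of a constant and two independent centred functions. -/
lemma integral_sq_add_add {F G : (List Bool → ℝ) → ℝ} {A B : ℝ} (g : ℝ) (hF : Centered F A)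
    (hG : Centered G B) :
    Integrable (fun p : (List Bool → ℝ) × (List Bool → ℝ) => g + F p.1 + G p.2)
        (treeLaw.prod treeLaw) ∧
      ∫ p, (g + F p.1 + G p.2) ∂(treeLaw.prod treeLaw) = g ∧
      Integrable (fun p : (List Bool → ℝ) × (List Bool → ℝ) => (g + F p.1 + G p.2) ^ 2)
        (treeLaw.prod treeLaw) ∧
      ∫ p, (g + F p.1 + G p.2) ^ 2 ∂(treeLaw.prod treeLaw) ≤ g ^ 2 + A + B := by
  have iF := hF.integrable.comp_fst treeLaw
  have iG := hG.integrable.comp_snd treeLaw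
  have iF2 := hF.memLp.integrable_sq.comp_fst treeLaw
  have iG2 := hG.memLp.integrable_sq.comp_snd treeLaw
  have iFG := hF.integrable.mul_prod hG.integrable
  have eF : ∫ p : (List Bool → ℝ) × (List Bool → ℝ), F p.1 ∂(treeLaw.prod treeLaw) = 0 := by
    rw [integral_fun_fst, hF.mean, smul_zero]
  have eG : ∫ p : (List Bool → ℝ) × (List Bool → ℝ), G p.2 ∂(treeLaw.prod treeLaw) = 0 := by
    rw [integral_fun_snd, hG.mean, smul_zero]
  have eF2 : ∫ p : (List Bool → ℝ) × (List Bool → ℝ), F p.1 ^ 2 ∂(treeLaw.prod treeLaw) ≤ A := by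
    rw [integral_fun_fst (fun u => F u ^ 2)]
    simpa using hF.moment
  have eG2 : ∫ p : (List Bool → ℝ) × (List Bool → ℝ), G p.2 ^ 2 ∂(treeLaw.prod treeLaw) ≤ B := by
    rw [integral_fun_snd (fun u => G u ^ 2)]
    simpa using hG.moment
  -- Independence and mean zero remove all cross terms, so the second moments simply add.
  have eFG : ∫ p : (List Bool → ℝ) × (List Bool → ℝ), F p.1 * G p.2 ∂(treeLaw.prod treeLaw)
      = 0 := by
    rw [integral_prod_mul, hF.mean, zero_mul]
  have ig : Integrable (fun _ : (List Bool → ℝ) × (List Bool → ℝ) => g) (treeLaw.prod treeLaw) :=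
    integrable_const g
  have ig2 : Integrable (fun _ : (List Bool → ℝ) × (List Bool → ℝ) => g ^ 2)
      (treeLaw.prod treeLaw) := integrable_const _
  have hsq : (fun p : (List Bool → ℝ) × (List Bool → ℝ) => (g + F p.1 + G p.2) ^ 2)
      = fun p => g ^ 2 + F p.1 ^ 2 + G p.2 ^ 2 + 2 * g * F p.1 + 2 * g * G p.2
        + 2 * (F p.1 * G p.2) := by
    funext p
    ring
  have i0 : Integrable (fun p : (List Bool → ℝ) × (List Bool → ℝ) => g + F p.1)
    (treeLaw.prod treeLaw) := ig.add iF
  have i1 : Integrable (fun p : (List Bool → ℝ) × (List Bool → ℝ) => g ^ 2 + F p.1 ^ 2)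
    (treeLaw.prod treeLaw) := ig2.add iF2
  have i2 : Integrable (fun p : (List Bool → ℝ) × (List Bool → ℝ) =>
    g ^ 2 + F p.1 ^ 2 + G p.2 ^ 2) (treeLaw.prod treeLaw) := i1.add iG2
  have i3 : Integrable (fun p : (List Bool → ℝ) × (List Bool → ℝ) =>
    g ^ 2 + F p.1 ^ 2 + G p.2 ^ 2 + 2 * g * F p.1) (treeLaw.prod treeLaw) :=
    i2.add (iF.const_mul (2 * g))
  have i4 : Integrable (fun p : (List Bool → ℝ) × (List Bool → ℝ) =>
    g ^ 2 + F p.1 ^ 2 + G p.2 ^ 2 + 2 * g * F p.1 + 2 * g * G p.2) (treeLaw.prod treeLaw) :=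
    i3.add (iG.const_mul (2 * g))
  refine ⟨i0.add iG, ?_, ?_, ?_⟩
  · rw [integral_add i0 iG, integral_add ig iF, eF, eG]
    simp
  · rw [hsq]
    exact i4.add (iFG.const_mul 2)
  · rw [hsq]
    rw [integral_add i4 (iFG.const_mul 2), integral_add i3 (iG.const_mul (2 * g)), integral_add i2 (iF.const_mul (2 * g)),
      integral_add i1 iG2, integral_add ig2 iF2, integral_const_mul, integral_const_mul,
      integral_const_mul, eF, eG, eFG]
    simp
    linarith

/-! ### Contraction of second moments along the recursion -/

lemma integral_unif_id_sq : ∫ x, x ^ 2 ∂unif = 1 / 3 := by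
  rw [unif, integral_Icc_eq_integral_Ioc, ← intervalIntegral.integral_of_le zero_le_one]
  norm_num [integral_pow]

lemma integral_unif_one_sub_sq : ∫ x, (1 - x) ^ 2 ∂unif = 1 / 3 := by
  rw [unif, integral_Icc_eq_integral_Ioc, ← intervalIntegral.integral_of_le zero_le_one,
    intervalIntegral.integral_comp_sub_left (fun x : ℝ => x ^ 2)]
  norm_num [integral_pow]

/-- The moments of a function of a tree which splits into a function of the root and, given
the root, centred functions of the two subtrees: the second moments contract by `2 / 3`. -/
lemma centered_of_split {g : ℝ → ℝ} {F G : ℝ → (List Bool → ℝ) → ℝ} {K c : ℝ}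
    (hg : Measurable g) (hF : Measurable (Function.uncurry F))
    (hG : Measurable (Function.uncurry G)) (hgK : ∀ x ∈ Set.Ioo (0 : ℝ) 1, |g x| ≤ K)
    (hg0 : ∫ x, g x ∂unif = 0) (hFc : ∀ x ∈ Set.Ioo (0 : ℝ) 1, Centered (F x) (c * x ^ 2))
    (hGc : ∀ x ∈ Set.Ioo (0 : ℝ) 1, Centered (G x) (c * (1 - x) ^ 2)) :
    Centered (fun u => g (u []) + F (u []) (sub false u) + G (u []) (sub true u))
      (K ^ 2 + 2 / 3 * c) := by
  set h : ℝ × (List Bool → ℝ) × (List Bool → ℝ) → ℝ :=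
    fun p => g p.1 + F p.1 p.2.1 + G p.1 p.2.2 with hh
  have hhm : Measurable h := by
    have h1 : Measurable fun p : ℝ × (List Bool → ℝ) × (List Bool → ℝ) => F p.1 p.2.1 :=
      hF.comp (by fun_prop : Measurable fun p : ℝ × (List Bool → ℝ) × (List Bool → ℝ) =>
        (p.1, p.2.1))
    have h2 : Measurable fun p : ℝ × (List Bool → ℝ) × (List Bool → ℝ) => G p.1 p.2.2 :=
      hG.comp (by fun_prop : Measurable fun p : ℝ × (List Bool → ℝ) × (List Bool → ℝ) =>
        (p.1, p.2.2))
    exact ((hg.comp measurable_fst).add h1).add h2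
  have hinner := fun x (hx : x ∈ Set.Ioo (0 : ℝ) 1) =>
    integral_sq_add_add (g x) (hFc x hx) (hGc x hx)
  have hbd : ∀ᵐ x ∂unif, ∫ p, h (x, p) ^ 2 ∂(treeLaw.prod treeLaw)
      ≤ K ^ 2 + c * x ^ 2 + c * (1 - x) ^ 2 := by
    filter_upwards [ae_unif_mem] with x hx
    refine (hinner x hx).2.2.2.trans ?_
    have : g x ^ 2 ≤ K ^ 2 := sq_le_sq' (neg_le_of_abs_le (hgK x hx)) (le_of_abs_le (hgK x hx))
    linarith
  have ix : Integrable (fun x : ℝ => x ^ 2) unif :=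
    (continuous_pow 2).continuousOn.integrableOn_compact isCompact_Icc
  have ix' : Integrable (fun x : ℝ => (1 - x) ^ 2) unif :=
    (by fun_prop : Continuous fun x : ℝ => (1 - x) ^ 2).continuousOn.integrableOn_compact
      isCompact_Icc
  have ib0 : Integrable (fun x : ℝ => K ^ 2 + c * x ^ 2) unif :=
    (integrable_const _).add (ix.const_mul c)
  have ib : Integrable (fun x : ℝ => K ^ 2 + c * x ^ 2 + c * (1 - x) ^ 2) unif :=
    ib0.add (ix'.const_mul c)
  -- The factor `2 / 3` is the sum of the second moments `1 / 3` of `x` and of `1 - x`.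
  have eb : ∫ x, (K ^ 2 + c * x ^ 2 + c * (1 - x) ^ 2) ∂unif = K ^ 2 + 2 / 3 * c := by
    rw [integral_add ib0 (ix'.const_mul c),
      integral_add (integrable_const _) (ix.const_mul c), integral_const_mul, integral_const_mul,
      integral_unif_id_sq, integral_unif_one_sub_sq]
    simp
    ring
  have hsq : Integrable (fun p => h p ^ 2) (unif.prod (treeLaw.prod treeLaw)) := by
    rw [integrable_prod_iff (by fun_prop)]
    refine ⟨?_, ?_⟩
    · filter_upwards [ae_unif_mem] with x hx using (hinner x hx).2.2.1
    · refine ib.mono' (hhm.pow_const 2).stronglyMeasurable.norm.integral_prod_right'.aestronglyMeasurable ?_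
      filter_upwards [hbd] with x hx
      rw [Real.norm_of_nonneg (integral_nonneg fun p => norm_nonneg _)]
      simpa using hx
  have hLp : MemLp h 2 (unif.prod (treeLaw.prod treeLaw)) :=
    (memLp_two_iff_integrable_sq (by fun_prop)).2 hsq
  have hi : Integrable h (unif.prod (treeLaw.prod treeLaw)) := hLp.integrable (by norm_num)
  refine ⟨hLp.comp_measurePreserving measurePreserving_split, ?_, ?_⟩
  · have : ∫ u, h (split u) ∂treeLaw = ∫ p, h p ∂(unif.prod (treeLaw.prod treeLaw)) := by
      rw [← measurePreserving_split.map_eq, integral_map (by fun_prop)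
        (by fun_prop)]
    refine this.trans ?_
    rw [integral_prod _ hi, ← hg0]
    refine integral_congr_ae ?_
    filter_upwards [ae_unif_mem] with x hx using (hinner x hx).2.1
  · have : ∫ u, h (split u) ^ 2 ∂treeLaw = ∫ p, h p ^ 2 ∂(unif.prod (treeLaw.prod treeLaw)) := by
      rw [← measurePreserving_split.map_eq, integral_map (by fun_prop)
        (by fun_prop)]
    refine this.trans_le ?_
    rw [integral_prod _ hsq, ← eb]
    exact integral_mono_ae hsq.integral_prod_left ib hbd

end QuicksortProcess

end

noncomputable section

namespace QuicksortProcess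

/-! ## The rank of the pivot -/

/-- The number of elements smaller than the pivot among `n` elements, as a function of a uniform
variable. -/
def rank (n : ℕ) (x : ℝ) : ℕ := min ⌊n * x⌋₊ (n - 1)

@[fun_prop] lemma measurable_rank (n : ℕ) : Measurable (rank n) := by
  unfold rank
  exact (Nat.measurable_floor.comp (measurable_const_mul _)).min measurable_const

/-- The minimum in `rank` matters only for `x ≥ 1`, a null event; thanks to it the recursion shrinks
for every tree and not just almost surely. -/
lemma rank_lt {n : ℕ} (hn : 0 < n) (x : ℝ) : rank n x < n := by
  have := min_le_right ⌊n * x⌋₊ (n - 1)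
  unfold rank
  omega

lemma rank_of_lt {n : ℕ} {x : ℝ} (hx : x ∈ Set.Ioo (0 : ℝ) 1) : rank n x = ⌊n * x⌋₊ := by
  rcases n.eq_zero_or_pos with rfl | hn
  · simp [rank]
  · refine min_eq_left (Nat.le_sub_one_of_lt ?_)
    rw [Nat.floor_lt (by have := hx.1; positivity)]
    have : (0 : ℝ) < n := by exact_mod_cast hn
    nlinarith [hx.2]

lemma rank_le {n : ℕ} {x : ℝ} (hx : x ∈ Set.Ioo (0 : ℝ) 1) : (rank n x : ℝ) ≤ x * n := by
  rw [rank_of_lt hx, mul_comm x]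
  exact Nat.floor_le (by have := hx.1; positivity)

lemma lt_rank_add_one {n : ℕ} {x : ℝ} (hx : x ∈ Set.Ioo (0 : ℝ) 1) :
    x * n < rank n x + 1 := by
  rw [rank_of_lt hx, mul_comm x]
  exact Nat.lt_floor_add_one _

lemma sub_rank_le {n : ℕ} {x : ℝ} (hn : 0 < n) (hx : x ∈ Set.Ioo (0 : ℝ) 1) :
    ((n - 1 - rank n x : ℕ) : ℝ) ≤ (1 - x) * n := by
  have h1 := rank_lt hn x
  have h2 := lt_rank_add_one (n := n) hx
  have h3 : n - 1 - rank n x = n - (rank n x + 1) := by omega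
  rw [h3, Nat.cast_sub (by omega)]
  push_cast
  linarith

/-- Up to a null set the rank is `j` on an interval of length `1 / n`, so the coupled pivot is
uniform. -/
lemma unif_rank_eq {n j : ℕ} (hj : j < n) : unif (rank n ⁻¹' {j}) = ENNReal.ofReal (1 / n) := by
  have hn : (0 : ℝ) < n := by exact_mod_cast (j.zero_le.trans_lt hj)
  have h : rank n ⁻¹' {j} =ᵐ[unif] Set.Ico ((j : ℝ) / n) ((j + 1) / n) := by
    filter_upwards [ae_unif_mem] with x hx
    have : (rank n x = j) ↔ ((j : ℝ) / n ≤ x ∧ x < (j + 1) / n) := by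
      rw [rank_of_lt hx, Nat.floor_eq_iff (by have := hx.1; positivity), div_le_iff₀ hn,
        lt_div_iff₀ hn, mul_comm (n : ℝ)]
    exact propext this
  have hsub : Set.Ico ((j : ℝ) / n) ((j + 1) / n) ⊆ Set.Icc 0 1 := by
    intro x hx
    refine ⟨le_trans (by positivity) hx.1, hx.2.le.trans ?_⟩
    rw [div_le_one hn]
    exact_mod_cast hj
  rw [measure_congr h, unif, Measure.restrict_apply measurableSet_Ico,
    Set.inter_eq_left.2 hsub, Real.volume_Ico]
  congr 1
  ring

lemma map_rank {n : ℕ} (hn : 0 < n) :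
    unif.map (rank n) = ∑ j ∈ Finset.range n, ENNReal.ofReal (1 / n) • Measure.dirac j := by
  refine Measure.ext_of_singleton fun j => ?_
  rw [Measure.map_apply (measurable_rank n) (measurableSet_singleton j),
    Measure.finsetSum_apply]
  simp only [Measure.smul_apply, Measure.dirac_apply, smul_eq_mul]
  by_cases hj : j < n
  · rw [unif_rank_eq hj, Finset.sum_eq_single j]
    · simp
    · intro i _ hij
      simp [hij]
    · simp [hj]
  · have : rank n ⁻¹' {j} = ∅ := by
      ext x
      have := rank_lt hn x
      simp only [Set.mem_preimage, Set.mem_singleton_iff, Set.mem_empty_iff_false, iff_false]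
      omega
    rw [this, measure_empty, Finset.sum_eq_zero]
    intro i hi
    have : i ≠ j := by rintro rfl; exact hj (Finset.mem_range.1 hi)
    simp [this]

lemma integral_rank {n : ℕ} (hn : 0 < n) (f : ℕ → ℝ) :
    ∫ x, f (rank n x) ∂unif = 1 / n * ∑ j ∈ Finset.range n, f j := by
  have h : ∫ x, f (rank n x) ∂unif = ∫ j, f j ∂(unif.map (rank n)) :=
    (integral_map (by fun_prop) (measurable_of_countable f).aestronglyMeasurable).symm
  rw [h, map_rank hn, integral_finsetSum_measure]
  · simp only [integral_smul_measure, integral_dirac, smul_eq_mul]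
    rw [Finset.mul_sum, ENNReal.toReal_ofReal (by positivity)]
  · intro i _
    exact (integrable_dirac (by simp)).smul_measure (by simp)

lemma lintegral_rank {n : ℕ} (hn : 0 < n) (f : ℕ → ENNReal) :
    ∫⁻ x, f (rank n x) ∂unif = ∑ j ∈ Finset.range n, ENNReal.ofReal (1 / n) * f j := by
  have h : ∫⁻ x, f (rank n x) ∂unif = ∫⁻ j, f j ∂(unif.map (rank n)) :=
    (lintegral_map (measurable_of_countable f) (by fun_prop)).symm
  rw [h, map_rank hn, lintegral_finsetSum_measure]
  simp

/-! ## The recursion -/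

section Recursion

-- The values are left general because the recursion is used twice: in `ℕ` with toll `n - 1` it
-- counts comparisons, in `ℝ` with the centred toll it gives the centred running time.
variable {R : Type*} [AddMonoid R]

/-- The recursion of Quicksort on the fly, to depth `m`: the total toll paid until the `l`-th of
`n` elements is returned, if `τ n l j` is the toll paid for splitting at a pivot of rank `j`. -/
def running (τ : ℕ → ℕ → ℕ → R) : ℕ → (List Bool → ℝ) → ℕ → ℕ → R
  | 0, _, _, _ => 0
  | m + 1, u, n, l =>
    if n ≤ 1 ∨ l = 0 then 0 else
      τ n l (rank n (u [])) +
        if l ≤ rank n (u []) then running τ m (sub false u) (rank n (u [])) l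
        else running τ m (sub false u) (rank n (u [])) (rank n (u [])) +
          running τ m (sub true u) (n - 1 - rank n (u [])) (l - (rank n (u []) + 1))

variable (τ : ℕ → ℕ → ℕ → R)

lemma running_of_le {m n l : ℕ} (u : List Bool → ℝ) (h : n ≤ 1 ∨ l = 0) :
    running τ m u n l = 0 := by
  cases m <;> simp [running, h]

lemma running_succ {m n l : ℕ} (u : List Bool → ℝ) (hn : 1 < n) (hl : 0 < l) :
    running τ (m + 1) u n l = τ n l (rank n (u [])) +
        if l ≤ rank n (u []) then running τ m (sub false u) (rank n (u [])) l
        else running τ m (sub false u) (rank n (u [])) (rank n (u [])) +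
          running τ m (sub true u) (n - 1 - rank n (u [])) (l - (rank n (u []) + 1)) := by
  rw [running, if_neg (by omega)]

/-- The recursion stops at depth `n`. -/
lemma running_eq_of_le {m n l : ℕ} (u : List Bool → ℝ) (h : n ≤ m) :
    running τ m u n l = running τ n u n l := by
  induction m using Nat.strong_induction_on generalizing n l u with
  | _ m ih =>
    by_cases hn : n ≤ 1 ∨ l = 0
    · rw [running_of_le τ u hn, running_of_le τ u hn]
    obtain ⟨n, rfl⟩ : ∃ k, n = k + 1 := ⟨n - 1, by omega⟩
    obtain ⟨m, rfl⟩ : ∃ k, m = k + 1 := ⟨m - 1, by omega⟩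
    have hr : rank (n + 1) (u []) < n + 1 := rank_lt n.succ_pos _
    rw [running_succ τ u (by omega) (by omega), running_succ τ u (by omega) (by omega)]
    rcases (Nat.le_of_succ_le_succ h).eq_or_lt with rfl | hlt
    · rfl
    have e : ∀ (v : List Bool → ℝ) (k l : ℕ), k ≤ n →
        running τ m v k l = running τ n v k l := by
      intro v k l hk
      rw [ih m (by omega) v (by omega : k ≤ m), ih n (by omega) v hk]
    rw [e _ _ _ (by omega), e _ _ _ (by omega), e _ _ _ (by omega)]

lemma measurable_running [MeasurableSpace R] [MeasurableAdd₂ R] (m n l : ℕ) :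
    Measurable fun u => running τ m u n l := by
  induction m generalizing n l with
  | zero => exact measurable_const
  | succ m ih =>
    by_cases hn : n ≤ 1 ∨ l = 0
    · simp only [running, if_pos hn]
      exact measurable_const
    -- The root enters only through its rank, a natural number, so measurability can be checked for
    -- each rank separately.
    have h : Measurable fun p : ℕ × (List Bool → ℝ) => τ n l p.1 +
        if l ≤ p.1 then running τ m (sub false p.2) p.1 l
        else running τ m (sub false p.2) p.1 p.1 +
          running τ m (sub true p.2) (n - 1 - p.1) (l - (p.1 + 1)) := by
      refine measurable_from_prod_countable_right fun j => ?_
      have h0 := fun k l => (ih k l).comp (measurable_sub false)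
      have h1 := fun k l => (ih k l).comp (measurable_sub true)
      simp only [Function.comp_def] at h0 h1
      refine (measurable_const (a := τ n l j)).add ?_
      by_cases hl : l ≤ j
      · simpa only [if_pos hl] using h0 j l
      · simp only [if_neg hl]
        exact (h0 j j).add (h1 _ _)
    simp only [running, if_neg hn]
    exact h.comp (f := fun u : List Bool → ℝ => (rank n (u []), u)) (by fun_prop)

end Recursion

/-- The number of comparisons made until the `l`-th of `n` elements is returned. -/
def comparisons (u : List Bool → ℝ) (n l : ℕ) : ℕ :=
  running (fun n _ _ => n - 1) n u n l

lemma comparisons_of_le {n l : ℕ} (u : List Bool → ℝ) (h : n ≤ 1 ∨ l = 0) :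
    comparisons u n l = 0 :=
  running_of_le _ u h

lemma comparisons_eq {n l : ℕ} (u : List Bool → ℝ) (hn : 1 < n) (hl : 0 < l) :
    comparisons u n l = n - 1 +
        if l ≤ rank n (u []) then comparisons (sub false u) (rank n (u [])) l
        else comparisons (sub false u) (rank n (u [])) (rank n (u [])) +
          comparisons (sub true u) (n - 1 - rank n (u [])) (l - (rank n (u []) + 1)) := by
  have hr := rank_lt (by omega : 0 < n) (u [])
  unfold comparisons
  obtain ⟨n, rfl⟩ : ∃ k, n = k + 1 := ⟨n - 1, by omega⟩
  rw [running_succ _ u hn hl]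
  rw [running_eq_of_le _ _ (by omega : rank (n + 1) (u []) ≤ n),
    running_eq_of_le _ _ (by omega : rank (n + 1) (u []) ≤ n),
    running_eq_of_le _ _ (by omega : n + 1 - 1 - rank (n + 1) (u []) ≤ n)]

@[fun_prop] lemma measurable_comparisons (n l : ℕ) : Measurable fun u => comparisons u n l :=
  measurable_running _ n n l

/-! ## Expectations -/

/-- The expected number of comparisons made until the `l`-th of `n` elements is returned. -/
def meanCost (n l : ℕ) : ℝ :=
  -- This closed form is justified by `sum_toll` and `integral_comparisons`. The case `l = 0` is
  -- separate because the formula does not vanish there in general.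
  if l = 0 then 0 else 2 * n + 2 * (n + 1) * harmonic n
    - 2 * (n + 3 - l) * harmonic (n + 1 - l) - 6 * l + 6

/-- The centred toll for splitting `n` elements at a pivot of rank `j`. -/
def toll (n l j : ℕ) : ℝ :=
  n - 1 + (if l ≤ j then meanCost j l else meanCost j j + meanCost (n - 1 - j) (l - (j + 1)))
    - meanCost n l

lemma meanCost_self (n : ℕ) : meanCost n n = 2 * (n + 1) * harmonic n - 4 * n := by
  unfold meanCost
  split_ifs with h
  · simp [h]
  · simp
    ring

lemma cast_harmonic_succ (n : ℕ) :
    ((harmonic (n + 1) : ℚ) : ℝ) * (n + 1) = harmonic n * (n + 1) + 1 := by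
  rw [harmonic_succ]
  push_cast
  field_simp

lemma sum_harmonic (n : ℕ) : ∑ i ∈ Finset.range n, 2 * ((i : ℝ) + 1) * (harmonic i : ℝ)
    = n * (n + 1) * (harmonic n : ℝ) - n * (n + 3) / 2 := by
  induction n with
  | zero => simp
  | succ n ih =>
    rw [Finset.sum_range_succ, ih]
    have := cast_harmonic_succ n
    push_cast
    linear_combination (-(n : ℝ) - 2) * this

lemma sum_harmonic_shift (q n : ℕ) :
    ∑ i ∈ Finset.range n, 2 * ((q : ℝ) + i + 1) * (harmonic (q + i) : ℝ)
    = ((q + n) * (q + n + 1) * (harmonic (q + n) : ℝ) - (q + n) * (q + n + 3) / 2) -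
      (q * (q + 1) * (harmonic q : ℝ) - q * (q + 3) / 2) := by
  have h := Finset.sum_range_add (fun i : ℕ => 2 * ((i : ℝ) + 1) * (harmonic i : ℝ)) q n
  rw [sum_harmonic, sum_harmonic] at h
  push_cast at h
  rw [h]
  ring

lemma sum_harmonic_succ (n : ℕ) :
    ∑ i ∈ Finset.range n, 2 * ((i : ℝ) + 3) * (harmonic (i + 1) : ℝ)
    = (n + 1) * (n + 4) * (harmonic n : ℝ) - n * (n + 7) / 2 := by
  induction n with
  | zero => simp
  | succ n ih =>
    rw [Finset.sum_range_succ, ih]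
    have := cast_harmonic_succ n
    push_cast
    linear_combination (-(n : ℝ) - 4) * this

/-- The toll has mean zero. -/
lemma sum_toll {n l : ℕ} (hl : 0 < l) (hln : l ≤ n) :
    ∑ j ∈ Finset.range n, toll n l j = 0 := by
  -- Writing `l = p + 1` and `n = p + 1 + d` removes the truncated subtractions. Ranks `j ≤ p`
  -- contribute a complete left part and some of the right part, ranks `j > p` only some of the left
  -- part.
  obtain ⟨p, rfl⟩ : ∃ p, l = p + 1 := ⟨l - 1, by omega⟩
  obtain ⟨d, rfl⟩ := Nat.exists_eq_add_of_le hln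
  have h1 : ∑ j ∈ Finset.range (p + 1), meanCost j j
      = (p + 1) * (p + 2) * (harmonic (p + 1) : ℝ) - (p + 1) * (p + 4) / 2
        - 4 * ∑ j ∈ Finset.range (p + 1), (j : ℝ) := by
    simp only [meanCost_self]
    rw [Finset.sum_sub_distrib, sum_harmonic, Finset.mul_sum]
    push_cast
    ring
  have h2 : ∑ j ∈ Finset.range (p + 1), meanCost (p + 1 + d - 1 - j) (p + 1 - (j + 1))
      = ∑ i ∈ Finset.range p, (2 * (((d + 1 : ℕ) : ℝ) + i + 1) * (harmonic (d + 1 + i) : ℝ)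
          + (2 * (d + 1) - 2 * (d + 3) * (harmonic (d + 1) : ℝ)) - 4 * i) := by
    -- After reflection the first term is the rank `j = p`, where the pivot is the sought element
    -- itself and nothing of the right part is needed.
    rw [← Finset.sum_range_reflect, Finset.sum_range_succ', show meanCost
      (p + 1 + d - 1 - (p + 1 - 1 - 0)) (p + 1 - (p + 1 - 1 - 0 + 1)) = 0 by simp [meanCost],
      add_zero]
    refine Finset.sum_congr rfl fun i hi => ?_
    have hi := Finset.mem_range.1 hi
    rw [show p + 1 + d - 1 - (p + 1 - 1 - (i + 1)) = d + 1 + i by omega,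
      show p + 1 - (p + 1 - 1 - (i + 1) + 1) = i + 1 by omega, meanCost, if_neg (by omega),
      show d + 1 + i + 1 - (i + 1) = d + 1 by omega]
    push_cast
    ring
  have h3 : ∑ k ∈ Finset.range d, meanCost (p + 1 + k) (p + 1)
      = ∑ k ∈ Finset.range d, (2 * (((p + 1 : ℕ) : ℝ) + k + 1) * (harmonic (p + 1 + k) : ℝ)
          - 2 * ((k : ℝ) + 3) * (harmonic (k + 1) : ℝ) + (2 - 4 * p) + 2 * k) := by
    refine Finset.sum_congr rfl fun k _ => ?_
    rw [meanCost, if_neg (by omega), show p + 1 + k + 1 - (p + 1) = k + 1 by omega]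
    push_cast
    ring
  have hsum : ∀ m : ℕ, ∑ i ∈ Finset.range m, (i : ℝ) = m * (m - 1) / 2 := by
    intro m
    induction m with
    | zero => simp
    | succ m ih => rw [Finset.sum_range_succ, ih]; push_cast; ring
  have h4 : ∑ j ∈ Finset.range (p + 1 + d), toll (p + 1 + d) (p + 1) j
      = ∑ j ∈ Finset.range (p + 1), meanCost j j
        + ∑ j ∈ Finset.range (p + 1), meanCost (p + 1 + d - 1 - j) (p + 1 - (j + 1))
        + ∑ k ∈ Finset.range d, meanCost (p + 1 + k) (p + 1)
        + (p + 1 + d) * ((p + 1 + d) - 1 - meanCost (p + 1 + d) (p + 1)) := by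
    have h5 : ∀ j ∈ Finset.range (p + 1), toll (p + 1 + d) (p + 1) j = meanCost j j
        + meanCost (p + 1 + d - 1 - j) (p + 1 - (j + 1))
        + ((p + 1 + d) - 1 - meanCost (p + 1 + d) (p + 1)) := by
      intro j hj
      have := Finset.mem_range.1 hj
      rw [toll, if_neg (by omega)]
      push_cast
      ring
    have h6 : ∀ k ∈ Finset.range d, toll (p + 1 + d) (p + 1) (p + 1 + k) =
        meanCost (p + 1 + k) (p + 1) + ((p + 1 + d) - 1 - meanCost (p + 1 + d) (p + 1)) := by
      intro k _
      rw [toll, if_pos (by omega)]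
      push_cast
      ring
    rw [Finset.sum_range_add, Finset.sum_congr rfl h5, Finset.sum_congr rfl h6,
      Finset.sum_add_distrib, Finset.sum_add_distrib, Finset.sum_add_distrib]
    simp only [Finset.sum_const, Finset.card_range, nsmul_eq_mul]
    push_cast
    ring
  rw [h4, h1, h2, h3]
  simp only [Finset.sum_sub_distrib, Finset.sum_add_distrib, sum_harmonic_shift,
    sum_harmonic_succ, ← Finset.mul_sum, hsum, Finset.sum_const, Finset.card_range, nsmul_eq_mul]
  rw [meanCost, if_neg (by omega), show p + 1 + d + 1 - (p + 1) = d + 1 by omega,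
    show d + 1 + p = p + 1 + d by omega]
  -- All that is left is a multiple of the relation between `harmonic (d + 1)` and `harmonic d`.
  have := cast_harmonic_succ d
  push_cast
  linear_combination ((d : ℝ) + 4) * this

end QuicksortProcess

end

noncomputable section

namespace QuicksortProcess

/-! ## The size of the toll -/

/-- The discrete version of the function `x log x`. -/
def harmonicEntropy (n k : ℕ) : ℝ := k * ((harmonic k : ℝ) - harmonic n)

lemma harmonic_real_mono {k n : ℕ} (h : k ≤ n) : (harmonic k : ℝ) ≤ harmonic n := by
  have : Monotone harmonic := monotone_nat_of_le_succ fun m => by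
    rw [harmonic_succ]
    exact le_add_of_nonneg_right (by positivity)
  exact_mod_cast this h

lemma harmonic_real_nonneg (k : ℕ) : (0 : ℝ) ≤ harmonic k := by
  simpa using harmonic_real_mono (Nat.zero_le k)

/-- Each of the `d` added terms is at most `1 / (k + 1)`. -/
lemma harmonic_add_le (k d : ℕ) :
    (k + 1) * ((harmonic (k + d) : ℝ) - harmonic k) ≤ d := by
  induction d with
  | zero => simp
  | succ d ih =>
    rw [← add_assoc, harmonic_succ]
    push_cast
    have : ((k : ℝ) + 1) * ((k : ℝ) + d + 1)⁻¹ ≤ 1 := by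
      rw [← div_eq_mul_inv, div_le_one (by positivity)]
      linarith [(Nat.cast_nonneg d : (0 : ℝ) ≤ d)]
    linarith

lemma harmonic_le_self (n : ℕ) : (harmonic n : ℝ) ≤ n := by
  simpa using harmonic_add_le 0 n

lemma abs_harmonicEntropy_le {n k : ℕ} (h : k ≤ n) : |harmonicEntropy n k| ≤ n := by
  obtain ⟨d, rfl⟩ := Nat.exists_eq_add_of_le h
  have h1 := harmonic_add_le k d
  have h2 := harmonic_real_mono h
  have h3 : (0 : ℝ) ≤ k := Nat.cast_nonneg k
  unfold harmonicEntropy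
  rw [abs_of_nonpos (by nlinarith)]
  push_cast
  linarith

/-- The terms of order `n log n` cancel. The form separates what survives division by `n`, namely
linear terms and entropies, from harmonic numbers, which are of order `log n`. -/
lemma toll_of_le {n l j : ℕ} (hl : 0 < l) (hlj : l ≤ j) (hj : j < n) :
    toll n l j = -n - 1 + 2 * j + 2 * (harmonicEntropy n j - harmonicEntropy n (j + 1 - l)
      + harmonicEntropy n (n + 1 - l))
      + 2 * ((harmonic j : ℝ) - 2 * harmonic (j + 1 - l) - harmonic n
      + 2 * harmonic (n + 1 - l)) := by
  rw [toll, if_pos hlj, meanCost, meanCost, if_neg (by omega), if_neg (by omega)]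
  simp only [harmonicEntropy]
  rw [Nat.cast_sub (by omega : l ≤ j + 1), Nat.cast_sub (by omega : l ≤ n + 1)]
  push_cast
  ring

lemma toll_of_lt {n l j : ℕ} (hlj : j + 1 < l) (hl : l ≤ n) :
    toll n l j = n + 3 + 2 * (harmonicEntropy n j + harmonicEntropy n (n - 1 - j))
      + 2 * ((harmonic j : ℝ) + harmonic (n - 1 - j) - 2 * harmonic n) := by
  rw [toll, if_neg (by omega), meanCost_self, meanCost, meanCost, if_neg (by omega),
    if_neg (by omega), show n - 1 - j + 1 - (l - (j + 1)) = n + 1 - l by omega]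
  simp only [harmonicEntropy]
  obtain ⟨d, rfl⟩ := Nat.exists_eq_add_of_le (by omega : j + 1 ≤ n)
  rw [Nat.cast_sub hlj.le, show j + 1 + d - 1 - j = d by omega]
  push_cast
  ring

/-- This case stands alone because `meanCost _ 0 = 0` departs from the closed form. It matters only
for the uniform bound: in the limit the time differs from the pivot. -/
lemma toll_self {n j : ℕ} (hj : j < n) :
    toll n (j + 1) j = n + 3 + 2 * (harmonicEntropy n j + harmonicEntropy n (n - 1 - j))
      + 2 * ((harmonic j : ℝ) + harmonic (n - 1 - j) - 2 * harmonic n)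
      - 2 * (n - 1 - j : ℕ) - 4 + 4 * harmonic (n - j) := by
  obtain ⟨d, rfl⟩ := Nat.exists_eq_add_of_le (by omega : j + 1 ≤ n)
  rw [toll, if_neg (by omega), meanCost_self, meanCost, meanCost, if_pos (by omega),
    if_neg (by omega), show j + 1 + d + 1 - (j + 1) = d + 1 by omega,
    show j + 1 + d - 1 - j = d by omega, show j + 1 + d - j = d + 1 by omega]
  simp only [harmonicEntropy]
  have := cast_harmonic_succ d
  push_cast
  linear_combination 2 * this

/-- Every entropy and every harmonic number that occurs is at most `n` in absolute value; the
constant `30` is crude. -/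
lemma abs_toll_le {n l j : ℕ} (hl : 0 < l) (hln : l ≤ n) (hj : j < n) :
    |toll n l j| ≤ 30 * n := by
  have hn : (1 : ℝ) ≤ n := by exact_mod_cast (by omega : 1 ≤ n)
  have hjn : (j : ℝ) ≤ n := by exact_mod_cast hj.le
  have hj0 : (0 : ℝ) ≤ j := Nat.cast_nonneg j
  have e := fun {k : ℕ} (hk : k ≤ n) => abs_le.1 (abs_harmonicEntropy_le hk)
  have h := fun {k : ℕ} (hk : k ≤ n) => (harmonic_real_mono hk).trans (harmonic_le_self n)
  have h0 := harmonic_real_nonneg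
  have ej := e hj.le
  have hj' := h hj.le
  have hj0' := h0 j
  have hn' := h (le_refl n)
  have hn0' := h0 n
  rw [abs_le]
  rcases lt_trichotomy (j + 1) l with h1 | rfl | h1
  · rw [toll_of_lt h1 hln]
    have hk : n - 1 - j ≤ n := by omega
    have := e hk; have := h hk; have := h0 (n - 1 - j)
    constructor <;> linarith
  · rw [toll_self hj]
    have hk : n - 1 - j ≤ n := by omega
    have hk' : n - j ≤ n := by omega
    have := e hk; have := h hk; have := h0 (n - 1 - j)
    have := h hk'; have := h0 (n - j)
    have : ((n - 1 - j : ℕ) : ℝ) ≤ n := by exact_mod_cast hk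
    have : (0 : ℝ) ≤ (n - 1 - j : ℕ) := Nat.cast_nonneg _
    constructor <;> linarith
  · rw [toll_of_le hl (by omega) hj]
    have hk : j + 1 - l ≤ n := by omega
    have hk' : n + 1 - l ≤ n := by omega
    have := e hk; have := h hk; have := h0 (j + 1 - l)
    have := e hk'; have := h hk'; have := h0 (n + 1 - l)
    constructor <;> linarith

/-! ## The limit of the toll -/

section Limit

variable {N k l : ℕ → ℕ} {x t : ℝ}

lemma tendsto_atTop_of_ratio (hN : Tendsto N atTop atTop)
    (hk : Tendsto (fun i => (k i : ℝ) / N i) atTop (𝓝 x)) (hx : 0 < x) :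
    Tendsto k atTop atTop := by
  have h1 : Tendsto (fun i => (N i : ℝ)) atTop atTop :=
    tendsto_natCast_atTop_atTop.comp hN
  refine tendsto_natCast_atTop_iff (R := ℝ).1 ((h1.atTop_mul_pos hx hk).congr' ?_)
  filter_upwards [hN.eventually_gt_atTop 0] with i hi
  have : (N i : ℝ) ≠ 0 := by exact_mod_cast hi.ne'
  field_simp

lemma tendsto_harmonic_div (hN : Tendsto N atTop atTop) (hk : ∀ i, k i ≤ N i) :
    Tendsto (fun i => (harmonic (k i) : ℝ) / N i) atTop (𝓝 0) := by
  have h1 : Tendsto (fun n : ℕ => (1 + Real.log n) / n) atTop (𝓝 0) := by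
    have h2 : Tendsto (fun n : ℕ => Real.log n / (n : ℝ)) atTop (𝓝 0) :=
      (Real.isLittleO_log_id_atTop.tendsto_div_nhds_zero).comp tendsto_natCast_atTop_atTop
    have h3 := (tendsto_const_div_atTop_nhds_zero_nat (1 : ℝ)).add h2
    simpa [add_div] using h3
  refine squeeze_zero (fun i => div_nonneg (harmonic_real_nonneg _) (Nat.cast_nonneg _))
    (fun i => ?_) (h1.comp hN)
  exact div_le_div_of_nonneg_right ((harmonic_real_mono (hk i)).trans
    (harmonic_le_one_add_log (N i))) (Nat.cast_nonneg _)

/-- Since `harmonic k - log k` converges to Euler's constant, the constants cancel in the difference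
and `log (k / N)` remains. -/
lemma tendsto_harmonicEntropy (hN : Tendsto N atTop atTop)
    (hk : Tendsto (fun i => (k i : ℝ) / N i) atTop (𝓝 x)) (hx : 0 < x) :
    Tendsto (fun i => harmonicEntropy (N i) (k i) / N i) atTop (𝓝 (x * Real.log x)) := by
  have hkt := tendsto_atTop_of_ratio hN hk hx
  have h := hk.mul (((Real.tendsto_harmonic_sub_log.comp hkt).sub
    (Real.tendsto_harmonic_sub_log.comp hN)).add (hk.log hx.ne'))
  simp only [sub_self, zero_add] at h
  refine h.congr' ?_
  filter_upwards [hN.eventually_gt_atTop 0, hkt.eventually_gt_atTop 0] with i hi hi'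
  have h1 : (N i : ℝ) ≠ 0 := by exact_mod_cast hi.ne'
  have h2 : (k i : ℝ) ≠ 0 := by exact_mod_cast hi'.ne'
  simp only [Function.comp, harmonicEntropy]
  rw [Real.log_div h2 h1]
  ring

lemma tendsto_ratio_sub (hN : Tendsto N atTop atTop) (hle : ∀ᶠ i in atTop, l i ≤ k i + 1)
    (hk : Tendsto (fun i => (k i : ℝ) / N i) atTop (𝓝 x))
    (hl : Tendsto (fun i => (l i : ℝ) / N i) atTop (𝓝 t)) :
    Tendsto (fun i => ((k i + 1 - l i : ℕ) : ℝ) / N i) atTop (𝓝 (x - t)) := by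
  have h1 : Tendsto (fun i => (1 : ℝ) / N i) atTop (𝓝 0) :=
    (tendsto_const_div_atTop_nhds_zero_nat (1 : ℝ)).comp hN
  have h := (hk.add h1).sub hl
  rw [add_zero] at h
  refine h.congr' ?_
  filter_upwards [hle] with i hi
  rw [Nat.cast_sub hi]
  push_cast
  ring

lemma tendsto_ratio_compl (hN : Tendsto N atTop atTop) (hkN : ∀ᶠ i in atTop, k i < N i)
    (hk : Tendsto (fun i => (k i : ℝ) / N i) atTop (𝓝 x)) :
    Tendsto (fun i => ((N i - 1 - k i : ℕ) : ℝ) / N i) atTop (𝓝 (1 - x)) := by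
  have h1 : Tendsto (fun i => (1 : ℝ) / N i) atTop (𝓝 0) :=
    (tendsto_const_div_atTop_nhds_zero_nat (1 : ℝ)).comp hN
  have h := ((tendsto_const_nhds (x := (1 : ℝ))).sub h1).sub hk
  rw [sub_zero] at h
  refine h.congr' ?_
  filter_upwards [hkN] with i hi
  have : (N i : ℝ) ≠ 0 := by exact_mod_cast (by omega : N i ≠ 0)
  rw [Nat.cast_sub (by omega), Nat.cast_sub (by omega)]
  field_simp
  push_cast
  ring

lemma eventually_lt_of_ratio_lt (hN : Tendsto N atTop atTop)
    (hk : Tendsto (fun i => (k i : ℝ) / N i) atTop (𝓝 x))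
    (hl : Tendsto (fun i => (l i : ℝ) / N i) atTop (𝓝 t)) (hxt : x < t) :
    ∀ᶠ i in atTop, k i + 1 < l i := by
  have h1 : Tendsto (fun i => (1 : ℝ) / N i) atTop (𝓝 0) :=
    (tendsto_const_div_atTop_nhds_zero_nat (1 : ℝ)).comp hN
  have h := hk.add h1
  rw [add_zero] at h
  filter_upwards [h.eventually_lt hl hxt, hN.eventually_gt_atTop 0] with i hi hi'
  have : (0 : ℝ) < N i := by exact_mod_cast hi'
  rw [← add_div, div_lt_div_iff_of_pos_right this] at hi
  exact_mod_cast hi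

lemma tendsto_toll_of_lt (hN : Tendsto N atTop atTop) (hkN : ∀ᶠ i in atTop, k i < N i)
    (hk : Tendsto (fun i => (k i : ℝ) / N i) atTop (𝓝 x))
    (hl : Tendsto (fun i => (l i : ℝ) / N i) atTop (𝓝 t)) (ht : 0 < t) (htx : t < x)
    (hx : x < 1) :
    Tendsto (fun i => toll (N i) (l i) (k i) / N i) atTop (𝓝 (costAt t x)) := by
  have hkl : ∀ᶠ i in atTop, l i < k i := by
    filter_upwards [eventually_lt_of_ratio_lt hN hl hk htx] with i hi
    omega
  have hl0 : ∀ᶠ i in atTop, 0 < l i :=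
    (tendsto_atTop_of_ratio hN hl ht).eventually_gt_atTop 0
  have h1 : Tendsto (fun i => (N i : ℝ) / N i) atTop (𝓝 1) := by
    refine tendsto_const_nhds.congr' ?_
    filter_upwards [hN.eventually_gt_atTop 0] with i hi
    rw [div_self (by exact_mod_cast hi.ne')]
  have hb := tendsto_ratio_sub hN (hkl.mono fun i hi => by omega) hk hl
  have hc := tendsto_ratio_sub hN (by filter_upwards [hkl, hkN] with i h h'; omega) h1 hl
  -- `tendsto_harmonic_div` asks for the bound at every index; a minimum with `N i` makes an
  -- eventual bound enough.
  have hmin : ∀ f : ℕ → ℕ, (∀ᶠ i in atTop, f i ≤ N i) →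
      Tendsto (fun i => (harmonic (f i) : ℝ) / N i) atTop (𝓝 0) := by
    intro f hf
    refine (tendsto_harmonic_div (k := fun i => min (f i) (N i)) hN
      fun i => min_le_right _ _).congr' ?_
    filter_upwards [hf] with i hi
    rw [min_eq_left hi]
  have e1 := tendsto_harmonicEntropy hN hk (ht.trans htx)
  have e2 := tendsto_harmonicEntropy hN hb (sub_pos.2 htx)
  have e3 := tendsto_harmonicEntropy hN hc (sub_pos.2 (htx.trans hx))
  have g1 := hmin k (hkN.mono fun i h => h.le)
  have g2 := hmin _ (by filter_upwards [hkl, hkN, hl0] with i h h' h''; omega :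
    ∀ᶠ i in atTop, k i + 1 - l i ≤ N i)
  have g3 := hmin N (by simp)
  have g4 := hmin _ (by filter_upwards [hkl, hkN, hl0] with i h h' h''; omega :
    ∀ᶠ i in atTop, N i + 1 - l i ≤ N i)
  have h2 : Tendsto (fun i => (1 : ℝ) / N i) atTop (𝓝 0) :=
    (tendsto_const_div_atTop_nhds_zero_nat (1 : ℝ)).comp hN
  have h := (((h1.neg.sub h2).add (hk.const_mul 2)).add (((e1.sub e2).add e3).const_mul 2)).add
    ((((g1.sub (g2.const_mul 2)).sub g3).add (g4.const_mul 2)).const_mul 2)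
  have hval : costAt t x = -1 - 0 + 2 * x + 2 * (x * Real.log x - (x - t) * Real.log (x - t)
      + (1 - t) * Real.log (1 - t)) + 2 * (0 - 2 * 0 - 0 + 2 * 0) := by
    rw [costAt, if_pos htx, cost]
    ring
  rw [hval]
  refine h.congr' ?_
  filter_upwards [hkl, hkN, hl0] with i i1 i2 i3
  rw [toll_of_le i3 i1.le i2]
  ring

lemma tendsto_toll_of_gt (hN : Tendsto N atTop atTop) (hkN : ∀ᶠ i in atTop, k i < N i)
    (hlN : ∀ᶠ i in atTop, l i ≤ N i)
    (hk : Tendsto (fun i => (k i : ℝ) / N i) atTop (𝓝 x))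
    (hl : Tendsto (fun i => (l i : ℝ) / N i) atTop (𝓝 t)) (hx : 0 < x) (htx : x < t)
    (hx1 : x < 1) :
    Tendsto (fun i => toll (N i) (l i) (k i) / N i) atTop (𝓝 (costAt t x)) := by
  have hc := tendsto_ratio_compl hN hkN hk
  have e1 := tendsto_harmonicEntropy hN hk hx
  have e2 := tendsto_harmonicEntropy hN hc (sub_pos.2 hx1)
  have g1 := tendsto_harmonic_div (k := fun i => min (k i) (N i)) hN fun i => min_le_right _ _
  have g2 := tendsto_harmonic_div (k := fun i => N i - 1 - k i) hN fun i => by omega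
  have g3 := tendsto_harmonic_div hN (fun i => le_refl (N i))
  have h2 : Tendsto (fun i => (3 : ℝ) / N i) atTop (𝓝 0) :=
    (tendsto_const_div_atTop_nhds_zero_nat (3 : ℝ)).comp hN
  have h := (((tendsto_const_nhds (x := (1 : ℝ))).add h2).add ((e1.add e2).const_mul 2)).add
    (((g1.add g2).sub (g3.const_mul 2)).const_mul 2)
  have hval : costAt t x = 1 + 0 + 2 * (x * Real.log x + (1 - x) * Real.log (1 - x))
      + 2 * (0 + 0 - 2 * 0) := by
    rw [costAt, if_neg htx.not_gt, cost]
    ring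
  rw [hval]
  refine h.congr' ?_
  filter_upwards [eventually_lt_of_ratio_lt hN hk hl htx, hkN, hlN] with i i1 i2 i3
  have : (N i : ℝ) ≠ 0 := by exact_mod_cast (by omega : N i ≠ 0)
  rw [toll_of_lt i1 i3, min_eq_left i2.le]
  field_simp

end Limit

/-! ## Second moments of the centred running times -/

lemma measurable_comp_rank {H : ℕ → (List Bool → ℝ) → ℝ} (n : ℕ) (hH : ∀ k, Measurable (H k)) :
    Measurable (Function.uncurry fun x u => H (rank n x) u) := by
  have h : Measurable fun p : ℕ × (List Bool → ℝ) => H p.1 p.2 :=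
    measurable_from_prod_countable_right hH
  exact h.comp (f := fun p : ℝ × (List Bool → ℝ) => (rank n p.1, p.2)) (by fun_prop)

/-- The quicksort recursion for the second moments of the centred running times. -/
lemma centered_split_rank {c K : ℝ} (hc : 0 ≤ c) {n l : ℕ} (hn : 0 < n) (hln : l ≤ n)
    {τ : ℕ → ℝ} (hτ : ∀ j < n, |τ j| ≤ K) (hτ0 : ∑ j ∈ Finset.range n, τ j = 0)
    {H : (List Bool → ℝ) → ℕ → ℕ → ℝ} (hm : ∀ k l, Measurable fun u => H u k l)
    (hH : ∀ k l, l ≤ k → Centered (fun u => H u k l) (c * k ^ 2)) :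
    Centered (fun u => τ (rank n (u [])) +
        if l ≤ rank n (u []) then H (sub false u) (rank n (u [])) l
        else H (sub false u) (rank n (u [])) (rank n (u [])) +
          H (sub true u) (n - 1 - rank n (u [])) (l - (rank n (u []) + 1)))
      (K ^ 2 + 2 / 3 * (c * n ^ 2)) := by
  refine (centered_of_split (g := fun x => τ (rank n x))
    (F := fun x u => H u (rank n x) (if l ≤ rank n x then l else rank n x))
    (G := fun x u => if l ≤ rank n x then 0 else H u (n - 1 - rank n x) (l - (rank n x + 1)))
    (K := K) (c := c * n ^ 2)
    ((measurable_of_countable τ).comp (measurable_rank n))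
    (measurable_comp_rank (H := fun k u => H u k (if l ≤ k then l else k)) n fun k => hm _ _)
    (measurable_comp_rank
      (H := fun k u => if l ≤ k then 0 else H u (n - 1 - k) (l - (k + 1))) n fun k => ?_)
    (fun x _ => hτ _ (rank_lt hn x)) ?_ (fun x hx => ?_) (fun x hx => ?_)).congr
    (ae_of_all _ fun u => ?_)
  · split_ifs
    · exact measurable_const
    · exact hm _ _
  · rw [integral_rank hn, hτ0, mul_zero]
  -- The left part has at most `x n` elements, which turns the bound `c k ^ 2` into the form `c n ^
  -- 2 x ^ 2` that the contraction needs.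
  · refine (hH _ _ (by split_ifs <;> omega)).mono ?_
    have := rank_le (n := n) hx
    rw [mul_assoc, ← mul_pow, mul_comm (n : ℝ)]
    gcongr
  · split_ifs with h
    · exact Centered.zero (by positivity)
    · refine (hH _ _ (by omega)).mono ?_
      have := sub_rank_le (n := n) hn hx
      rw [mul_assoc, ← mul_pow, mul_comm (n : ℝ)]
      gcongr
  · simp only
    split_ifs <;> ring

/-- The constant solves `30 ^ 2 + 2 / 3 * c = c`. -/
lemma centered_running (m : ℕ) {n l : ℕ} (hl : l ≤ n) :
    Centered (fun u => running toll m u n l) (2700 * n ^ 2) := by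
  induction m generalizing n l with
  | zero => exact Centered.zero (by positivity)
  | succ m ih =>
    by_cases h : n ≤ 1 ∨ l = 0
    · simp only [running_of_le toll _ h]
      exact Centered.zero (by positivity)
    · simp only [running, if_neg h]
      refine (centered_split_rank (c := 2700) (K := 30 * n) (by norm_num) (by omega) hl
        (fun j hj => abs_toll_le (by omega) hl hj) (sum_toll (by omega) hl)
        (fun k l => measurable_running toll m k l) fun k l hkl => ih hkl).mono ?_
      linarith

/-- Cutting the recursion at depth `m` makes an exponentially small error, uniformly in `n`. -/
lemma centered_running_sub (m d : ℕ) {n l : ℕ} (hl : l ≤ n) :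
    Centered (fun u => running toll (m + d) u n l - running toll m u n l)
      (2700 * (2 / 3) ^ m * n ^ 2) := by
  induction m generalizing n l with
  | zero => simpa [running] using centered_running d hl
  | succ m ih =>
    by_cases h : n ≤ 1 ∨ l = 0
    · simp only [running_of_le toll _ h, sub_zero]
      exact Centered.zero (by positivity)
    -- Both recursions pay the same toll at the root, so it cancels and only the contraction
    -- remains.
    · refine ((centered_split_rank (c := 2700 * (2 / 3) ^ m) (K := 0) (τ := fun _ => 0)
        (H := fun u n l => running toll (m + d) u n l - running toll m u n l)
        (by positivity) (by omega : 0 < n) hl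
        (by simp) (by simp)
        (fun k l => (measurable_running toll _ k l).sub (measurable_running toll m k l))
        fun k l hkl => ih hkl).mono ?_).congr (ae_of_all _ fun u => ?_)
      · ring_nf
        rfl
      · rw [show m + 1 + d = m + d + 1 by ring]
        simp only [running, if_neg h]
        split_ifs <;> ring

/-- The centred running time in terms of the number of comparisons. -/
lemma running_toll_eq (u : List Bool → ℝ) {n l : ℕ} (hl : l ≤ n) :
    running toll n u n l = comparisons u n l - meanCost n l := by
  -- The means in the centred toll telescope along the recursion. A common depth `m ≥ n` ensures
  -- that it ends in the trivial cases, where `meanCost` vanishes.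
  have key : ∀ m n l (u : List Bool → ℝ), n ≤ m → l ≤ n →
      running toll m u n l = running (fun n _ _ => n - 1) m u n l - meanCost n l := by
    intro m
    induction m with
    | zero =>
      intro n l u hn hl
      obtain rfl : n = 0 := by omega
      obtain rfl : l = 0 := by omega
      simp [running, meanCost]
    | succ m ih =>
      intro n l u hn hl
      by_cases h : n ≤ 1 ∨ l = 0
      · rw [running_of_le _ u h, running_of_le _ u h]
        unfold meanCost
        split_ifs with h0
        · simp
        · obtain rfl : n = 1 := by omega
          obtain rfl : l = 1 := by omega
          norm_num
      · have hr := rank_lt (by omega : 0 < n) (u [])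
        rw [running_succ _ u (by omega) (by omega), running_succ _ u (by omega) (by omega), toll]
        split_ifs with h1
        · rw [ih _ _ _ (by omega) h1]
          push_cast [Nat.cast_sub (by omega : 1 ≤ n)]
          ring
        · rw [ih _ _ _ (by omega) le_rfl, ih _ _ _ (by omega) (by omega)]
          push_cast [Nat.cast_sub (by omega : 1 ≤ n)]
          ring
  exact key n n l u le_rfl hl

/-- The centred recursion has mean zero, so the number of comparisons has the mean that was
subtracted. -/
lemma integral_comparisons {n l : ℕ} (hl : l ≤ n) :
    ∫ u, (comparisons u n l : ℝ) ∂treeLaw = meanCost n l := by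
  have h := centered_running n hl
  have h1 : (fun u => (comparisons u n l : ℝ)) = fun u => running toll n u n l + meanCost n l := by
    funext u
    rw [running_toll_eq u hl]
    ring
  rw [h1, integral_add h.integrable (integrable_const _), h.mean]
  simp

end QuicksortProcess

end

noncomputable section

namespace QuicksortProcess

/-! ## The law of the running times -/

section Expectation

variable {α β : Type*}

/-- The expectation of a function with values in `[0, ∞]` under a discrete law. -/
def expect (p : PMF α) (f : α → ENNReal) : ENNReal := ∑' a, p a * f a

lemma expect_pure (a : α) (f : α → ENNReal) : expect (PMF.pure a) f = f a := by
  rw [expect, tsum_eq_single a]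
  · simp
  · intro b hb
    simp [PMF.pure_apply, hb]

/-- Sums of nonnegative terms can be exchanged; no measurable structure is needed on the outputs,
which are lists over the reals. -/
lemma expect_bind (p : PMF α) (q : α → PMF β) (f : β → ENNReal) :
    expect (p.bind q) f = expect p fun a => expect (q a) f := by
  simp only [expect, PMF.bind_apply, ← ENNReal.tsum_mul_right, ← ENNReal.tsum_mul_left]
  rw [ENNReal.tsum_comm]
  simp only [mul_assoc]

lemma expect_map (p : PMF α) (g : α → β) (f : β → ENNReal) :
    expect (p.map g) f = expect p fun a => f (g a) := by
  rw [PMF.map, expect_bind]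
  simp only [Function.comp, expect_pure]

lemma expect_uniformOfFintype [Fintype α] [Nonempty α] (f : α → ENNReal) :
    expect (PMF.uniformOfFintype α) f = ∑ a, (Fintype.card α : ENNReal)⁻¹ * f a := by
  simp [expect, tsum_fintype]

lemma toMeasure_eq_expect [MeasurableSpace α] (p : PMF α) {s : Set α} (hs : MeasurableSet s) :
    p.toMeasure s = expect p (s.indicator 1) := by
  rw [PMF.toMeasure_apply _ hs, expect]
  refine tsum_congr fun a => ?_
  by_cases h : a ∈ s <;> simp [h]

end Expectation

/-- The sum over a finite set of reals of a function of the ranks. -/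
lemma sum_rank_finset (S : Finset ℝ) (f : ℕ → ℕ → ENNReal) :
    ∑ p : S, f (S.filter (fun x => x < (p : ℝ))).card (S.filter (fun x => (p : ℝ) < x)).card
      = ∑ j ∈ Finset.range S.card, f j (S.card - 1 - j) := by
  classical
  set e := S.orderIsoOfFin rfl with he
  rw [Finset.sum_range, ← e.toEquiv.sum_comp]
  refine Finset.sum_congr rfl fun i _ => ?_
  have h1 : S.filter (fun x => x < ((e.toEquiv i : S) : ℝ))
      = (Finset.Iio i).image fun k => ((e k : S) : ℝ) := by
    ext x
    simp only [Finset.mem_filter, Finset.mem_image, Finset.mem_Iio]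
    constructor
    · rintro ⟨hx, hlt⟩
      refine ⟨e.symm ⟨x, hx⟩, ?_, by simp⟩
      rw [← e.lt_iff_lt, e.apply_symm_apply]
      exact hlt
    · rintro ⟨k, hk, rfl⟩
      exact ⟨(e k).2, by simpa using hk⟩
  have h2 : S.filter (fun x => ((e.toEquiv i : S) : ℝ) < x)
      = (Finset.Ioi i).image fun k => ((e k : S) : ℝ) := by
    ext x
    simp only [Finset.mem_filter, Finset.mem_image, Finset.mem_Ioi]
    constructor
    · rintro ⟨hx, hlt⟩
      refine ⟨e.symm ⟨x, hx⟩, ?_, by simp⟩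
      rw [← e.lt_iff_lt, e.apply_symm_apply]
      exact hlt
    · rintro ⟨k, hk, rfl⟩
      exact ⟨(e k).2, by simpa using hk⟩
  have hinj : Function.Injective fun k => ((e k : S) : ℝ) :=
    Subtype.val_injective.comp e.injective
  rw [h1, h2, Finset.card_image_of_injective _ hinj, Finset.card_image_of_injective _ hinj]
  simp

/-- The output of the algorithm started with the counter `c`, without the elements. -/
def output (u : List Bool → ℝ) (n c : ℕ) : List ℕ × ℕ :=
  ((List.range n).map fun l => c + comparisons u n (l + 1), c + comparisons u n n)

/-- The output is determined by finitely many natural numbers, so any function of it is measurable.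
The reduction modulo `n + 1` in `Fin.ofNat` has no effect on the indices used. -/
lemma measurable_output (n c : ℕ) (f : List ℕ × ℕ → ENNReal) :
    Measurable fun u => f (output u n c) := by
  have h1 : Measurable fun (u : List Bool → ℝ) (i : Fin (n + 1)) => comparisons u n i :=
    measurable_pi_lambda _ fun i => measurable_comparisons n i
  have h2 : Measurable fun v : Fin (n + 1) → ℕ =>
      f ((List.range n).map fun l => c + v (Fin.ofNat (n + 1) (l + 1)), c + v (Fin.last n)) :=
    measurable_of_countable _
  convert h2.comp h1 using 1
  funext u
  simp only [output, Function.comp, Fin.val_last]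
  congr 2
  refine List.map_congr_left fun l hl => ?_
  have := List.mem_range.1 hl
  rw [Fin.val_ofNat, Nat.mod_eq_of_lt (by omega)]

lemma output_of_le_one {u : List Bool → ℝ} {n c : ℕ} (hn : n ≤ 1) :
    output u n c = (List.replicate n c, c) := by
  have : n = 0 ∨ n = 1 := by omega
  rcases this with rfl | rfl <;> simp [output, comparisons_of_le]

/-- The recursion for the output of the algorithm. -/
lemma output_eq {u : List Bool → ℝ} {n : ℕ} (c : ℕ) (hn : 1 < n) :
    output u n c =
      (((output (sub false u) (rank n (u [])) (c + (n - 1))).1 ++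
        (output (sub false u) (rank n (u [])) (c + (n - 1))).2 ::
          (output (sub true u) (n - 1 - rank n (u []))
            (output (sub false u) (rank n (u [])) (c + (n - 1))).2).1),
        (output (sub true u) (n - 1 - rank n (u []))
            (output (sub false u) (rank n (u [])) (c + (n - 1))).2).2) := by
  have hr := rank_lt (by omega : 0 < n) (u [])
  refine Prod.ext ?_ ?_
  · simp only [output]
    obtain ⟨k, hk⟩ : ∃ k, n = rank n (u []) + (k + 1) := ⟨n - 1 - rank n (u []), by omega⟩
    have hk' : n - 1 - rank n (u []) = k := by omega
    have : List.range n = List.range (rank n (u [])) ++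
        (List.range (k + 1)).map (rank n (u []) + ·) := by
      conv_lhs => rw [hk]
      rw [List.range_add]
    rw [this, List.range_succ_eq_map, List.map_append, hk']
    congr 1
    · refine List.map_congr_left fun l hl => ?_
      have := List.mem_range.1 hl
      rw [comparisons_eq u hn (by omega), if_pos (by omega)]
      ring
    · simp only [List.map_cons, List.map_map]
      congr 1
      · rw [comparisons_eq u hn (by omega), if_neg (by omega), hk',
          comparisons_of_le (n := k) _ (Or.inr (by omega))]
        ring
      · refine List.map_congr_left fun l hl => ?_
        have := List.mem_range.1 hl
        simp only [Function.comp]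
        rw [comparisons_eq u hn (by omega), if_neg (by omega), hk',
          show rank n (u []) + l.succ + 1 - (rank n (u []) + 1) = l + 1 by omega]
        ring
  · simp only [output]
    rw [comparisons_eq u hn (by omega), if_neg (by omega),
      show n - (rank n (u []) + 1) = n - 1 - rank n (u []) by omega]
    ring

/-- Induction on the size: a uniform pivot corresponds to `rank` of the root, and the independent
recursive calls to independent subtrees. The counter `c` and the function `f` are general because
the right call starts from the final counter of the left one, and its expectation becomes the test
function for the left call. -/
lemma expect_quicksort (S : Finset ℝ) (c : ℕ) (f : List ℕ × ℕ → ENNReal) :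
    expect (quicksortOnTheFly S c) (fun r => f (r.1.map Prod.snd, r.2))
      = ∫⁻ u, f (output u S.card c) ∂treeLaw := by
  induction hn : S.card using Nat.strong_induction_on generalizing S c f with
  | _ n ih =>
  rw [quicksortOnTheFly]
  split_ifs with h
  · rw [expect_pure]
    simp only [output_of_le_one (hn ▸ h : n ≤ 1)]
    rw [lintegral_const, measure_univ, mul_one]
    simp [Function.comp_def, List.map_const', hn]
  · have hn1 : 1 < n := by omega
    have : Nonempty S :=
      (Finset.card_pos.mp (lt_trans Nat.zero_lt_one (not_le.mp h))).to_subtype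
    have hlt : ∀ p : S, (S.filter (fun x => x < (p : ℝ))).card < n := fun p => by
      rw [← hn]
      exact Finset.card_lt_card (Finset.filter_ssubset.mpr ⟨(p : ℝ), p.2, lt_irrefl _⟩)
    have hgt : ∀ p : S, (S.filter (fun x => (p : ℝ) < x)).card < n := fun p => by
      rw [← hn]
      exact Finset.card_lt_card (Finset.filter_ssubset.mpr ⟨(p : ℝ), p.2, lt_irrefl _⟩)
    simp only [expect_bind, expect_pure, List.map_append, List.map_cons]
    rw [expect_uniformOfFintype]
    -- With the elements forgotten, the contribution of a pivot depends only on the sizes of the two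
    -- parts.
    set Φ : ℕ → ℕ → ENNReal := fun j k => ∫⁻ u, ∫⁻ v,
      f ((output u j (c + (n - 1))).1 ++ (output u j (c + (n - 1))).2 ::
          (output v k (output u j (c + (n - 1))).2).1,
          (output v k (output u j (c + (n - 1))).2).2) ∂treeLaw ∂treeLaw with hΦ
    have hp : ∀ p : S, expect (quicksortOnTheFly (S.filter (fun x => x < (p : ℝ)))
        (c + (S.card - 1))) (fun left => expect (quicksortOnTheFly
          (S.filter (fun x => (p : ℝ) < x)) left.2)
          fun right => f (left.1.map Prod.snd ++ left.2 :: right.1.map Prod.snd, right.2))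
        = Φ (S.filter (fun x => x < (p : ℝ))).card (S.filter (fun x => (p : ℝ) < x)).card := by
      intro p
      have h1 := fun left : List (ℝ × ℕ) × ℕ => ih _ (hgt p) _ left.2
        (fun r => f (left.1.map Prod.snd ++ left.2 :: r.1, r.2)) rfl
      simp only at h1
      simp only [h1]
      have h2 := ih _ (hlt p) _ (c + (S.card - 1)) (fun r => ∫⁻ v, f (r.1 ++ r.2 ::
        (output v (S.filter (fun x => (p : ℝ) < x)).card r.2).1,
        (output v (S.filter (fun x => (p : ℝ) < x)).card r.2).2) ∂treeLaw) rfl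
      simp only at h2
      rw [h2, hn]
    simp only [hp]
    rw [sum_rank_finset S fun j k => (Fintype.card S : ENNReal)⁻¹ * Φ j k]
    have hcard : (Fintype.card S : ENNReal)⁻¹ = ENNReal.ofReal (1 / n) := by
      rw [Fintype.card_coe, hn, one_div, ENNReal.ofReal_inv_of_pos (by positivity),
        ENNReal.ofReal_natCast]
    rw [hcard, hn, ← lintegral_rank (by omega) fun j => Φ j (n - 1 - j)]
    have hm : Measurable fun p => f (output (node p) n c) :=
      (measurable_output n c f).comp measurable_node
    conv_rhs => rw [← map_node, lintegral_map (measurable_output n c f) measurable_node]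
    rw [lintegral_prod _ hm.aemeasurable]
    refine lintegral_congr fun x => ?_
    have hmx : Measurable fun q => f (output (node (x, q)) n c) :=
      hm.comp measurable_prodMk_left
    rw [lintegral_prod _ hmx.aemeasurable]
    have h0 : ∀ a b, sub false (node (x, a, b)) = a ∧ sub true (node (x, a, b)) = b :=
      fun a b => by
        have := split_node (x, a, b)
        exact ⟨congrArg (fun p => p.2.1) this, congrArg (fun p => p.2.2) this⟩
    refine lintegral_congr fun a => lintegral_congr fun b => ?_
    rw [output_eq c hn1, (h0 a b).1, (h0 a b).2, node_nil]

/-- The running times have the law of the numbers of comparisons in the random tree. -/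
lemma runningTimeLaw_toMeasure (S : Finset ℝ) :
    (runningTimeLaw S).toMeasure
      = treeLaw.map fun u l => if l ≤ S.card then comparisons u S.card l else 0 := by
  have hm : Measurable fun (u : List Bool → ℝ) (l : ℕ) =>
      if l ≤ S.card then comparisons u S.card l else 0 := by
    refine measurable_pi_lambda _ fun l => ?_
    split_ifs
    · fun_prop
    · exact measurable_const
  ext A hA
  rw [toMeasure_eq_expect _ hA, runningTimeLaw, expect_map, Measure.map_apply hm hA,
    ← lintegral_indicator_one (hm hA)]
  refine (expect_quicksort S 0 fun r => A.indicator 1 fun l => (0 :: r.1).getD l 0).trans ?_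
  refine lintegral_congr fun u => ?_
  have : (fun l => (0 :: (output u S.card 0).1).getD l 0)
      = fun l => if l ≤ S.card then comparisons u S.card l else 0 := by
    funext l
    cases l with
    | zero => simp [comparisons_of_le]
    | succ l =>
      simp only [output, zero_add, List.getD_cons_succ]
      split_ifs with h
      · rw [List.getD_eq_getElem _ _ (by simpa using h)]
        simp
      · rw [List.getD_eq_default _ _ (by simpa using h)]
  rw [this]
  rfl

end QuicksortProcess

end

noncomputable section

namespace QuicksortProcess

/-! ## Decomposition at the root -/

lemma sumWords_zero (f : List Bool → ℝ) : sumWords 0 f = 0 := by simp [sumWords]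

/-- Words are stored with the last letter first, so grouping by the first step from the root means
appending a letter at the end of the list. -/
lemma sumWords_succ (m : ℕ) (f : List Bool → ℝ) :
    sumWords (m + 1) f = f [] + (sumWords m (fun w => f (w ++ [false])) +
      sumWords m fun w => f (w ++ [true])) := by
  unfold sumWords
  rw [Finset.sum_range_succ', add_comm, ← Finset.sum_add_distrib]
  congr 1
  · simp
  · refine Finset.sum_congr rfl fun k _ => ?_
    have h : ∀ (i : Bool) (w : Fin k → Bool),
        List.ofFn (Fin.snocEquiv (fun _ => Bool) (i, w)) = List.ofFn w ++ [i] := by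
      intro i w
      rw [List.ofFn_succ']
      simp [Fin.snocEquiv]
    rw [← (Fin.snocEquiv fun _ : Fin (k + 1) => Bool).sum_comp, Fintype.sum_prod_type,
      Fintype.sum_bool, add_comm]
    simp only [h]

lemma sumWords_mul (m : ℕ) (c : ℝ) (f : List Bool → ℝ) :
    sumWords m (fun w => c * f w) = c * sumWords m f := by
  simp only [sumWords, Finset.mul_sum]

section Paths

variable (u : List Bool → ℝ)

/-- The subtree at the vertex `v`. -/
def subtree (v : List Bool) (u : List Bool → ℝ) : List Bool → ℝ := fun w => u (w ++ v)

lemma measurePreserving_subtree (v : List Bool) :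
    MeasurePreserving (subtree v) treeLaw treeLaw := by
  induction v with
  | nil =>
    have : subtree [] = id := by
      funext u w
      simp [subtree]
    rw [this]
    exact MeasurePreserving.id _
  | cons i v ih =>
    have : subtree (i :: v) = sub i ∘ subtree v := by
      funext u w
      simp [subtree, sub]
    rw [this]
    exact (measurePreserving_sub i).comp ih

lemma pathWeight_subtree (v w : List Bool) :
    pathWeight u v w = pathWeight (subtree v u) [] w := by
  induction w with
  | nil => rfl
  | cons i w ih =>
    rw [pathWeight, pathWeight, ih]
    simp [edge, subtree]

/-- The definition peels off the last edge of a path; a recursion at the root needs the first edge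
instead. -/
lemma pathWeight_append (i : Bool) (w : List Bool) :
    pathWeight u [] (w ++ [i]) = edge u [] i * pathWeight (sub i u) [] w := by
  induction w with
  | nil => simp [pathWeight]
  | cons j w ih =>
    rw [List.cons_append, pathWeight, pathWeight, ih, mul_assoc]
    simp [edge, sub]

lemma partialTotal_subtree (m : ℕ) (v : List Bool) :
    partialTotal u m v = partialTotal (subtree v u) m [] := by
  simp [partialTotal, pathWeight_subtree u v, subtree]

lemma total_subtree (v : List Bool) : total u v = total (subtree v u) [] := by
  simp only [total, partialTotal_subtree u _ v]

lemma total_child (i : Bool) : total u [i] = total (sub i u) [] :=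
  total_subtree u [i]

lemma partialTotal_zero (v : List Bool) : partialTotal u 0 v = 0 := sumWords_zero _

lemma partialTotal_succ (m : ℕ) :
    partialTotal u (m + 1) [] = cost (u []) + u [] * partialTotal (sub false u) m [] +
      (1 - u []) * partialTotal (sub true u) m [] := by
  simp only [partialTotal, sumWords_succ, pathWeight_append, List.append_nil, mul_assoc,
    sumWords_mul]
  simp [pathWeight, edge, sub, add_assoc]

/-- The first edge is peeled off as in `pathWeight_append`. Both components go together because the
space component is evaluated at the transformed time. -/
lemma path_append (i : Bool) (w : List Bool) (t : ℝ) :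
    (path u (w ++ [i])).1 t
        = edgeSpace u [] i t * (path (sub i u) w).1 (edgeTime u [] i t) ∧
      (path u (w ++ [i])).2 t = (path (sub i u) w).2 (edgeTime u [] i t) := by
  induction w with
  | nil => simp [path]
  | cons j w ih =>
    simp only [List.cons_append, path, ih.1, ih.2, Function.comp]
    refine ⟨?_, rfl⟩
    rw [mul_assoc]
    rfl

lemma vertexCost_append (i : Bool) (w : List Bool) (t : ℝ) :
    vertexCost u (w ++ [i]) t = vertexCost (sub i u) w t := by
  unfold vertexCost
  rw [total_subtree u, total_subtree (sub i u)]
  have : subtree (false :: (w ++ [i])) u = subtree (false :: w) (sub i u) := by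
    funext x
    simp [subtree, sub]
  rw [this]
  rfl

lemma partialProcess_zero (t : ℝ) : partialProcess u 0 t = 0 := sumWords_zero _

lemma partialProcess_succ (m : ℕ) (t : ℝ) :
    partialProcess u (m + 1) t = vertexCost u [] t +
      (edgeSpace u [] false t * partialProcess (sub false u) m (edgeTime u [] false t) +
       edgeSpace u [] true t * partialProcess (sub true u) m (edgeTime u [] true t)) := by
  simp only [partialProcess, sumWords_succ, (path_append u _ _ t).1, (path_append u _ _ t).2,
    vertexCost_append, mul_assoc, sumWords_mul]
  simp [path]

variable {u}

/-- The recursion for the partial sums of the Quicksort process. -/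
lemma partialProcess_succ_of_inner (hu : Inner u) (m : ℕ) (t : ℝ) :
    partialProcess u (m + 1) t = costAt t (u []) +
      if t < u [] then u [] * partialProcess (sub false u) m (t / u [])
      else u [] * total (sub false u) [] +
        (1 - u []) * partialProcess (sub true u) m ((t - u []) / (1 - u [])) := by
  have h0 := (hu []).1
  have h1 := (hu []).2
  rw [partialProcess_succ, vertexCost, total_child]
  -- Where an edge has nonzero space factor, the cut-offs `min 1` and `max 0` in its time
  -- transformation are inactive.
  by_cases h : t < u []
  · have : t / u [] ≤ 1 := by rw [div_le_one h0]; exact h.le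
    simp [edgeSpace, edgeTime, h, h.not_ge, this]
  · have : 0 ≤ (t - u []) / (1 - u []) := div_nonneg (by linarith) (by linarith)
    simp [edgeSpace, edgeTime, h, not_lt.1 h, this]
    ring

lemma Inner.time_left (hu : Inner u) {t : ℝ} (ht : t ∈ Set.Icc (0 : ℝ) 1) (h : t < u []) :
    t / u [] ∈ Set.Icc (0 : ℝ) 1 :=
  ⟨div_nonneg ht.1 (hu []).1.le, by rw [div_le_one (hu []).1]; exact h.le⟩

lemma Inner.time_right (hu : Inner u) {t : ℝ} (ht : t ∈ Set.Icc (0 : ℝ) 1) (h : ¬ t < u []) :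
    (t - u []) / (1 - u []) ∈ Set.Icc (0 : ℝ) 1 :=
  ⟨div_nonneg (by linarith) (by linarith [(hu []).2]), by
    rw [div_le_one (by linarith [(hu []).2])]
    linarith [ht.2]⟩

end Paths

/-! ## The cost functions -/

lemma abs_mul_log_le {x : ℝ} (hx : x ∈ Set.Icc (0 : ℝ) 1) : |x * Real.log x| ≤ 1 := by
  rcases hx.1.eq_or_lt with rfl | h
  · simp
  · rw [mul_comm]
    exact (Real.abs_log_mul_self_lt x h hx.2).le

lemma abs_cost_le {x : ℝ} (hx : x ∈ Set.Icc (0 : ℝ) 1) : |cost x| ≤ 5 := by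
  have h1 := abs_le.1 (abs_mul_log_le hx)
  have h2 := abs_le.1 (abs_mul_log_le (x := 1 - x) ⟨by linarith [hx.2], by linarith [hx.1]⟩)
  rw [abs_le, cost]
  constructor <;> linarith

lemma abs_costAt_le {t x : ℝ} (ht : t ∈ Set.Icc (0 : ℝ) 1) (hx : x ∈ Set.Icc (0 : ℝ) 1) :
    |costAt t x| ≤ 15 := by
  have h0 := abs_le.1 (abs_cost_le hx)
  rw [abs_le, costAt]
  split_ifs with h
  · have h1 := abs_le.1 (abs_mul_log_le (x := 1 - x) ⟨by linarith [hx.2], by linarith [hx.1]⟩)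
    have h2 := abs_le.1 (abs_mul_log_le (x := 1 - t) ⟨by linarith [ht.2], by linarith [ht.1]⟩)
    have h3 := abs_le.1 (abs_mul_log_le (x := x - t)
      ⟨by linarith, by linarith [hx.2, ht.1]⟩)
    have h4 := hx.1
    have h5 := hx.2
    constructor <;> linarith
  · constructor <;> linarith

@[fun_prop] lemma measurable_cost : Measurable cost := by
  unfold cost
  fun_prop

lemma measurable_costAt : Measurable fun p : ℝ × ℝ => costAt p.1 p.2 := by
  unfold costAt
  refine Measurable.add (by fun_prop) (Measurable.ite ?_ (by fun_prop) measurable_const)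
  exact measurableSet_lt measurable_fst measurable_snd

lemma tendsto_rank_div {x : ℝ} (hx : x ∈ Set.Ioo (0 : ℝ) 1) {N : ℕ → ℕ}
    (hN : Tendsto N atTop atTop) :
    Tendsto (fun i => (rank (N i) x : ℝ) / N i) atTop (𝓝 x) := by
  have h1 : Tendsto (fun i => (1 : ℝ) / N i) atTop (𝓝 0) :=
    (tendsto_const_div_atTop_nhds_zero_nat (1 : ℝ)).comp hN
  have h2 : Tendsto (fun i => x - 1 / N i) atTop (𝓝 x) := by
    simpa using h1.const_sub x
  refine tendsto_of_tendsto_of_tendsto_of_le_of_le' h2 tendsto_const_nhds ?_ ?_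
  · filter_upwards [hN.eventually_gt_atTop 0] with i hi
    have hpos : (0 : ℝ) < N i := by exact_mod_cast hi
    rw [le_div_iff₀ hpos, sub_mul, div_mul_cancel₀ _ hpos.ne']
    linarith [lt_rank_add_one (n := N i) hx]
  · filter_upwards [hN.eventually_gt_atTop 0] with i hi
    have hpos : (0 : ℝ) < N i := by exact_mod_cast hi
    rw [div_le_iff₀ hpos]
    exact rank_le hx

lemma costAt_one {x : ℝ} (hx : x < 1) : costAt 1 x = cost x := by
  rw [costAt, if_neg hx.not_gt, add_zero]

/-- The cost has mean zero, as the limit of centred tolls. -/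
lemma integral_cost : ∫ x, cost x ∂unif = 0 := by
  have h := tendsto_integral_of_dominated_convergence (μ := unif)
    (F := fun i x => toll (i + 1) (i + 1) (rank (i + 1) x) / ((i + 1 : ℕ) : ℝ)) (f := cost)
    (fun _ => 30) (fun i => ?_) (integrable_const _) (fun i => ?_) ?_
  · have h0 : ∀ i : ℕ, ∫ x, toll (i + 1) (i + 1) (rank (i + 1) x) / ((i + 1 : ℕ) : ℝ) ∂unif
        = 0 := by
      intro i
      rw [integral_div, integral_rank i.succ_pos, sum_toll i.succ_pos le_rfl]
      simp
    simp only [h0] at h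
    exact tendsto_nhds_unique h tendsto_const_nhds
  · exact ((measurable_of_countable (toll (i + 1) (i + 1))).comp
      (measurable_rank _)).div_const _ |>.aestronglyMeasurable
  · refine ae_of_all _ fun x => ?_
    have hpos : (0 : ℝ) < (i + 1 : ℕ) := by positivity
    rw [norm_div, Real.norm_eq_abs, Real.norm_of_nonneg hpos.le, div_le_iff₀ hpos]
    exact abs_toll_le i.succ_pos le_rfl (rank_lt i.succ_pos x)
  · filter_upwards [ae_unif_mem] with x hx
    have hN := tendsto_add_atTop_nat 1
    -- Taking `l = n` is the case `t = 1` of the limit of the toll.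
    rw [← costAt_one hx.2]
    refine tendsto_toll_of_gt hN (Eventually.of_forall fun i => rank_lt i.succ_pos x)
      (Eventually.of_forall fun i => le_rfl) (tendsto_rank_div hx hN) ?_ hx.1 hx.2 hx.2
    refine tendsto_const_nhds.congr fun i => ?_
    rw [div_self (by positivity)]

/-! ## The total cost -/

@[fun_prop] lemma measurable_partialTotal (m : ℕ) : Measurable fun u => partialTotal u m [] := by
  induction m with
  | zero => simp only [partialTotal_zero]; exact measurable_const
  | succ m ih =>
    have h0 := ih.comp (measurable_sub false)
    have h1 := ih.comp (measurable_sub true)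
    simp only [Function.comp_def] at h0 h1
    simp only [partialTotal_succ]
    fun_prop

@[fun_prop] lemma measurable_total : Measurable fun u => total u [] :=
  (StronglyMeasurable.limUnder (l := atTop)
    fun m => (measurable_partialTotal m).stronglyMeasurable).measurable

/-- The recursion for the second moments, for functions which are linear along the edges. -/
lemma centered_linear {g : ℝ → ℝ} {F G : (List Bool → ℝ) → ℝ} {K c : ℝ}
    (hg : Measurable g) (hF : Measurable F) (hG : Measurable G)
    (hgK : ∀ x ∈ Set.Ioo (0 : ℝ) 1, |g x| ≤ K) (hg0 : ∫ x, g x ∂unif = 0)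
    (hFc : Centered F c) (hGc : Centered G c) :
    Centered (fun u => g (u []) + u [] * F (sub false u) + (1 - u []) * G (sub true u))
      (K ^ 2 + 2 / 3 * c) :=
  centered_of_split (F := fun x u => x * F u) (G := fun x u => (1 - x) * G u) hg
    (by unfold Function.uncurry; fun_prop) (by unfold Function.uncurry; fun_prop) hgK hg0
    (fun x _ => mul_comm c _ ▸ hFc.const_mul x) (fun x _ => mul_comm c _ ▸ hGc.const_mul _)

/-- The constant solves `5 ^ 2 + 2 / 3 * c = c`. -/
lemma centered_partialTotal (m : ℕ) : Centered (fun u => partialTotal u m []) 75 := by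
  induction m with
  | zero => simp only [partialTotal_zero]; exact Centered.zero (by norm_num)
  | succ m ih =>
    simp only [partialTotal_succ]
    refine (centered_linear measurable_cost (measurable_partialTotal m)
      (measurable_partialTotal m) (fun x hx => abs_cost_le ⟨hx.1.le, hx.2.le⟩)
      integral_cost ih ih).mono (by norm_num)

lemma centered_partialTotal_sub (m d : ℕ) :
    Centered (fun u => partialTotal u (m + d) [] - partialTotal u m []) (75 * (2 / 3) ^ m) := by
  induction m with
  | zero => simpa [partialTotal_zero] using centered_partialTotal d
  | succ m ih =>
    refine ((centered_linear (g := fun _ => 0) (K := 0) measurable_const (by fun_prop)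
      (by fun_prop) (by simp) (by simp) ih ih).mono (le_of_eq (by ring))).congr
      (ae_of_all _ fun u => ?_)
    simp only
    rw [show m + 1 + d = m + d + 1 by ring, partialTotal_succ, partialTotal_succ]
    ring

/-- Both `75 < 9 ^ 2` and `2 / 3 < (9 / 10) ^ 2`; the point is a summable bound for the norms
without square roots. -/
lemma sqrt_rate_le (m : ℕ) : Real.sqrt (75 * (2 / 3) ^ m) < 9 * (9 / 10) ^ m := by
  rw [Real.sqrt_lt' (by positivity), mul_pow, ← pow_mul, mul_comm m 2, pow_mul]
  have : ((2 : ℝ) / 3) ^ m ≤ ((9 / 10) ^ 2) ^ m := pow_le_pow_left₀ (by norm_num) (by norm_num) m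
  have : (0 : ℝ) < ((9 / 10) ^ 2) ^ m := by positivity
  linarith

lemma ae_tendsto_total :
    ∀ᵐ u ∂treeLaw, Tendsto (fun m => partialTotal u m []) atTop (𝓝 (total u [])) := by
  have key : ∀ N n m : ℕ, N ≤ n → n ≤ m →
      eLpNorm ((fun u => partialTotal u m []) - fun u => partialTotal u n []) 2 treeLaw
        < ENNReal.ofReal (9 * (9 / 10) ^ N) := by
    intro N n m hN hnm
    obtain ⟨d, rfl⟩ := Nat.exists_eq_add_of_le hnm
    refine (centered_partialTotal_sub n d).eLpNorm_le.trans_lt ?_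
    refine (ENNReal.ofReal_lt_ofReal_iff (by positivity)).2 ((sqrt_rate_le n).trans_le ?_)
    exact mul_le_mul_of_nonneg_left
      (pow_le_pow_of_le_one (by norm_num) (by norm_num) hN) (by norm_num)
  have h := Lp.ae_tendsto_of_cauchy_eLpNorm (μ := treeLaw) (p := 2)
    (f := fun m u => partialTotal u m []) (B := fun N => ENNReal.ofReal (9 * (9 / 10) ^ N))
    (fun m => (measurable_partialTotal m).aestronglyMeasurable) (by norm_num)
    ((summable_geometric_of_lt_one (by norm_num) (by norm_num)).mul_left
      (9 : ℝ)).tsum_ofReal_ne_top (fun N n m hn hm => ?_)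
  · exact h.mono fun u hu => tendsto_nhds_limUnder hu
  · rcases le_total n m with h | h
    · rw [eLpNorm_sub_comm]
      exact key N n m hn h
    · exact key N m n hm h

/-- Mean zero and a bound for the second moment are preserved under limits which are both almost
sure and in mean square. -/
lemma Centered.of_tendsto {f : ℕ → (List Bool → ℝ) → ℝ} {g : (List Bool → ℝ) → ℝ} {c : ℝ}
    (hf : ∀ n, Centered (f n) c) (hg : Measurable g)
    (hlim : ∀ᵐ u ∂treeLaw, Tendsto (fun n => f n u) atTop (𝓝 (g u)))
    (hL : Tendsto (fun n => eLpNorm (f n - g) 2 treeLaw) atTop (𝓝 0)) :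
    Centered g c := by
  have hc : 0 ≤ c := (integral_nonneg fun u => sq_nonneg (f 0 u)).trans (hf 0).moment
  -- Fatou's lemma bounds the second moment of the limit; the mean passes to the limit because mean
  -- square convergence implies convergence in `L¹`.
  have h1 : eLpNorm g 2 treeLaw ≤ ENNReal.ofReal (Real.sqrt c) :=
    (Lp.eLpNorm_lim_le_liminf_eLpNorm (fun n => (hf n).memLp.1) g hlim).trans
      (liminf_le_of_frequently_le' (Frequently.of_forall fun n => (hf n).eLpNorm_le))
  have hgL : MemLp g 2 treeLaw := ⟨hg.aestronglyMeasurable, h1.trans_lt ENNReal.ofReal_lt_top⟩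
  refine ⟨hgL, ?_, ?_⟩
  · have h2 := tendsto_integral_of_L1' (μ := treeLaw) (F := f) (l := atTop) g hgL.1
      (Eventually.of_forall fun n => (hf n).integrable)
      (tendsto_of_tendsto_of_tendsto_of_le_of_le tendsto_const_nhds hL (fun n => zero_le)
        fun n => eLpNorm_le_eLpNorm_of_exponent_le (by norm_num)
          ((hf n).memLp.1.sub hg.aestronglyMeasurable))
    simp only [(hf _).mean] at h2
    exact tendsto_nhds_unique h2 tendsto_const_nhds
  · rw [hgL.eLpNorm_eq_integral_rpow_norm (by norm_num) (by norm_num),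
      ENNReal.ofReal_le_ofReal_iff (Real.sqrt_nonneg c), Real.sqrt_eq_rpow] at h1
    norm_num at h1
    exact (Real.rpow_le_rpow_iff (integral_nonneg fun u => sq_nonneg _) hc (by norm_num)).1 h1

/-- The limit `d → ∞` in `centered_partialTotal_sub`. The mean square convergence that this requires
follows from Fatou's lemma applied to the same bounds. -/
lemma centered_total_sub (m : ℕ) :
    Centered (fun u => total u [] - partialTotal u m []) (75 * (2 / 3) ^ m) := by
  have hlim : ∀ n, ∀ᵐ u ∂treeLaw, Tendsto (fun d => partialTotal u (n + d) [] - partialTotal u n [])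
      atTop (𝓝 (total u [] - partialTotal u n [])) := by
    intro n
    filter_upwards [ae_tendsto_total] with u hu
    simp only [add_comm n]
    exact (hu.comp (tendsto_add_atTop_nat n)).sub_const _
  have hbound : ∀ n, eLpNorm (fun u => total u [] - partialTotal u n []) 2 treeLaw
      ≤ ENNReal.ofReal (9 * (9 / 10) ^ n) := fun n =>
    (Lp.eLpNorm_lim_le_liminf_eLpNorm
      (fun d => (centered_partialTotal_sub n d).memLp.1) _ (hlim n)).trans
      (liminf_le_of_frequently_le' (Frequently.of_forall fun d =>
        (centered_partialTotal_sub n d).eLpNorm_le.trans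
          (ENNReal.ofReal_le_ofReal (sqrt_rate_le n).le)))
  have hto : Tendsto (fun n : ℕ => ENNReal.ofReal (9 * (9 / 10) ^ n)) atTop (𝓝 0) := by
    rw [← ENNReal.ofReal_zero]
    refine ENNReal.tendsto_ofReal ?_
    simpa using (tendsto_pow_atTop_nhds_zero_of_lt_one (by norm_num : (0 : ℝ) ≤ 9 / 10)
      (by norm_num)).const_mul 9
  refine Centered.of_tendsto (fun d => centered_partialTotal_sub m d) (by fun_prop) (hlim m) ?_
  refine tendsto_of_tendsto_of_tendsto_of_le_of_le tendsto_const_nhds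
    (hto.comp (tendsto_add_atTop_nat m)) (fun _ => zero_le) fun d => ?_
  refine le_of_eq_of_le ?_ (hbound (d + m))
  rw [eLpNorm_sub_comm]
  congr 1
  funext u
  simp only [Pi.sub_apply, add_comm m d]
  ring

end QuicksortProcess

end

noncomputable section

namespace QuicksortProcess

/-! ## Truncation of the process -/

/-- The Quicksort process with the recursion cut at depth `m`. -/
def trunc : ℕ → (List Bool → ℝ) → ℝ → ℝ
  | 0, _, _ => 0
  | m + 1, u, t => costAt t (u []) +
      if t < u [] then u [] * trunc m (sub false u) (t / u [])
      else u [] * trunc m (sub false u) 1 +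
        (1 - u []) * trunc m (sub true u) ((t - u []) / (1 - u []))

/-- The difference of the partial sum of the process and the process cut at depth `m`. -/
def truncError : ℕ → (List Bool → ℝ) → ℝ → ℝ
  | 0, _, _ => 0
  | m + 1, u, t =>
      if t < u [] then u [] * truncError m (sub false u) (t / u [])
      else u [] * (total (sub false u) [] - partialTotal (sub false u) m []) +
        (1 - u []) * truncError m (sub true u) ((t - u []) / (1 - u []))

lemma Inner.div_self {u : List Bool → ℝ} (hu : Inner u) :
    (1 - u []) / (1 - u []) = 1 :=
  _root_.div_self (by linarith [(hu []).2])

/-- The time `1` lies to the right of every pivot and is fixed by the right time transformation, so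
every subtree is charged in full. -/
lemma trunc_one (m : ℕ) {u : List Bool → ℝ} (hu : Inner u) :
    trunc m u 1 = partialTotal u m [] := by
  induction m generalizing u with
  | zero => rw [partialTotal_zero, trunc]
  | succ m ih =>
    rw [trunc, if_neg (hu []).2.not_gt, hu.div_self, ih (hu.sub _), ih (hu.sub _),
      costAt_one (hu []).2, partialTotal_succ]
    ring

lemma partialProcess_eq (m : ℕ) {u : List Bool → ℝ} (hu : Inner u) (t : ℝ) :
    partialProcess u m t = trunc m u t + truncError m u t := by
  induction m generalizing u t with
  | zero => simp [partialProcess_zero, trunc, truncError]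
  | succ m ih =>
    rw [partialProcess_succ_of_inner hu, trunc, truncError, trunc_one m (hu.sub _),
      ih (hu.sub _), ih (hu.sub _)]
    split_ifs <;> ring

lemma measurable_trunc (m : ℕ) : Measurable (Function.uncurry (trunc m)) := by
  induction m with
  | zero => exact measurable_const
  | succ m ih =>
    have h1 : Measurable fun p : (List Bool → ℝ) × ℝ => trunc m (sub false p.1) (p.2 / p.1 []) :=
      ih.comp (f := fun p : (List Bool → ℝ) × ℝ => (sub false p.1, p.2 / p.1 [])) (by fun_prop)
    have h2 : Measurable fun p : (List Bool → ℝ) × ℝ => trunc m (sub false p.1) 1 :=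
      ih.comp (f := fun p : (List Bool → ℝ) × ℝ => (sub false p.1, (1 : ℝ))) (by fun_prop)
    have h3 : Measurable fun p : (List Bool → ℝ) × ℝ =>
        trunc m (sub true p.1) ((p.2 - p.1 []) / (1 - p.1 [])) :=
      ih.comp (f := fun p : (List Bool → ℝ) × ℝ =>
        (sub true p.1, (p.2 - p.1 []) / (1 - p.1 []))) (by fun_prop)
    have h4 : Measurable fun p : (List Bool → ℝ) × ℝ => costAt p.2 (p.1 []) :=
      measurable_costAt.comp (f := fun p : (List Bool → ℝ) × ℝ => (p.2, p.1 [])) (by fun_prop)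
    refine h4.add (Measurable.ite (measurableSet_lt (by fun_prop) (by fun_prop)) ?_ ?_) <;>
      fun_prop

lemma measurable_truncError (m : ℕ) : Measurable (Function.uncurry (truncError m)) := by
  induction m with
  | zero => exact measurable_const
  | succ m ih =>
    have h1 : Measurable fun p : (List Bool → ℝ) × ℝ =>
        truncError m (sub false p.1) (p.2 / p.1 []) :=
      ih.comp (f := fun p : (List Bool → ℝ) × ℝ => (sub false p.1, p.2 / p.1 [])) (by fun_prop)
    have h3 : Measurable fun p : (List Bool → ℝ) × ℝ =>
        truncError m (sub true p.1) ((p.2 - p.1 []) / (1 - p.1 [])) :=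
      ih.comp (f := fun p : (List Bool → ℝ) × ℝ =>
        (sub true p.1, (p.2 - p.1 []) / (1 - p.1 []))) (by fun_prop)
    have h5 : Measurable fun p : (List Bool → ℝ) × ℝ => total (sub false p.1) [] :=
      measurable_total.comp (by fun_prop)
    have h6 : Measurable fun p : (List Bool → ℝ) × ℝ => partialTotal (sub false p.1) m [] :=
      (measurable_partialTotal m).comp (by fun_prop)
    refine Measurable.ite (measurableSet_lt (by fun_prop) (by fun_prop)) ?_ ?_ <;>
      fun_prop

/-- The error has no toll of its own: it comes from the tails of `Q` in completed left subtrees,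
whose second moment already has the required rate, and the contraction preserves that rate. -/
lemma centered_truncError (m : ℕ) (t : ℝ) :
    Centered (fun u => truncError m u t) (75 * (2 / 3) ^ m) := by
  induction m generalizing t with
  | zero => simp only [truncError]; exact Centered.zero (by norm_num)
  | succ m ih =>
    have hm := measurable_truncError m
    have h1 : Measurable fun p : ℝ × (List Bool → ℝ) => truncError m p.2 (t / p.1) :=
      hm.comp (f := fun p : ℝ × (List Bool → ℝ) => (p.2, t / p.1)) (by fun_prop)
    have h2 : Measurable fun p : ℝ × (List Bool → ℝ) =>
        truncError m p.2 ((t - p.1) / (1 - p.1)) :=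
      hm.comp (f := fun p : ℝ × (List Bool → ℝ) => (p.2, (t - p.1) / (1 - p.1))) (by fun_prop)
    have h3 : Measurable fun p : ℝ × (List Bool → ℝ) => total p.2 [] - partialTotal p.2 m [] :=
      (measurable_total.comp measurable_snd).sub
        ((measurable_partialTotal m).comp measurable_snd)
    have hset : MeasurableSet {p : ℝ × (List Bool → ℝ) | t < p.1} :=
      measurableSet_lt measurable_const measurable_fst
    refine ((centered_of_split (g := fun _ => 0) (K := 0) (c := 75 * (2 / 3) ^ m)
      (F := fun x a => if t < x then x * truncError m a (t / x)
        else x * (total a [] - partialTotal a m []))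
      (G := fun x a => if t < x then 0 else (1 - x) * truncError m a ((t - x) / (1 - x)))
      measurable_const ?_ ?_ (by simp) (by simp) (fun x _ => ?_) fun x _ => ?_).mono
      (le_of_eq (by ring))).congr (ae_of_all _ fun u => ?_)
    · exact Measurable.ite hset (measurable_fst.mul h1) (measurable_fst.mul h3)
    · exact Measurable.ite hset measurable_const ((measurable_const.sub measurable_fst).mul h2)
    · rw [mul_comm]
      split_ifs
      · exact (ih _).const_mul x
      · exact (centered_total_sub m).const_mul x
    · split_ifs
      · exact Centered.zero (by positivity)
      · rw [mul_comm]
        exact (ih _).const_mul (1 - x)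
    · simp only [truncError]
      split_ifs <;> ring

/-! ## Convergence of the truncated running times -/

/-- The time `t` is not hit by a pivot in the first `m` generations of the recursion. -/
def Generic : ℕ → (List Bool → ℝ) → ℝ → Prop
  | 0, _, _ => True
  | m + 1, u, t => t ≠ u [] ∧ (t < u [] → Generic m (sub false u) (t / u [])) ∧
      (u [] < t → Generic m (sub true u) ((t - u []) / (1 - u [])))

lemma generic_one (m : ℕ) {u : List Bool → ℝ} (hu : Inner u) : Generic m u 1 := by
  induction m generalizing u with
  | zero => trivial
  | succ m ih =>
    refine ⟨(hu []).2.ne', fun h => absurd h (hu []).2.not_gt, fun _ => ?_⟩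
    rw [hu.div_self]
    exact ih (hu.sub _)

lemma measurableSet_generic (m : ℕ) :
    MeasurableSet {p : (List Bool → ℝ) × ℝ | Generic m p.1 p.2} := by
  induction m with
  | zero => exact MeasurableSet.univ
  | succ m ih =>
    have h1 : MeasurableSet {p : (List Bool → ℝ) × ℝ | Generic m (sub false p.1) (p.2 / p.1 [])} :=
      (by fun_prop : Measurable fun p : (List Bool → ℝ) × ℝ => (sub false p.1, p.2 / p.1 [])) ih
    have h2 : MeasurableSet {p : (List Bool → ℝ) × ℝ |
        Generic m (sub true p.1) ((p.2 - p.1 []) / (1 - p.1 []))} :=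
      (by fun_prop : Measurable fun p : (List Bool → ℝ) × ℝ =>
        (sub true p.1, (p.2 - p.1 []) / (1 - p.1 []))) ih
    have h3 : MeasurableSet {p : (List Bool → ℝ) × ℝ | p.2 < p.1 []} :=
      measurableSet_lt (by fun_prop) (by fun_prop)
    have h4 : MeasurableSet {p : (List Bool → ℝ) × ℝ | p.1 [] < p.2} :=
      measurableSet_lt (by fun_prop) (by fun_prop)
    have h5 : MeasurableSet {p : (List Bool → ℝ) × ℝ | p.2 = p.1 []} :=
      measurableSet_eq_fun (by fun_prop) (by fun_prop)
    exact h5.compl.inter ((h3.imp h1).inter (h4.imp h2))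

/-- Given the pivots above it, each pivot has a law without atoms and is independent of the rescaled
time. -/
lemma ae_generic (m : ℕ) (t : ℝ) : ∀ᵐ u ∂treeLaw, Generic m u t := by
  induction m generalizing t with
  | zero => exact ae_of_all _ fun _ => trivial
  | succ m ih =>
    have hset : MeasurableSet {u | Generic (m + 1) u t} :=
      (by fun_prop : Measurable fun u : List Bool → ℝ => (u, t)) (measurableSet_generic (m + 1))
    rw [← map_node, ae_map_iff measurable_node.aemeasurable hset]
    refine (Measure.ae_prod_iff_ae_ae (measurable_node hset)).2 ?_
    filter_upwards [ae_unif_ne t] with x hx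
    have h1 := (measurePreserving_fst (μ := treeLaw) (ν := treeLaw)).quasiMeasurePreserving.ae
      (ih (t / x))
    have h2 := (measurePreserving_snd (μ := treeLaw) (ν := treeLaw)).quasiMeasurePreserving.ae
      (ih ((t - x) / (1 - x)))
    filter_upwards [h1, h2] with p hp1 hp2
    have hs := split_node (x, p)
    have e1 : sub false (node (x, p)) = p.1 := congrArg (fun p => p.2.1) hs
    have e2 : sub true (node (x, p)) = p.2 := congrArg (fun p => p.2.2) hs
    refine ⟨?_, fun _ => ?_, fun _ => ?_⟩
    · simpa using hx.symm
    · simpa [e1] using hp1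
    · simpa [e2] using hp2

/-- This is pathwise. Sizes and indices are arbitrary sequences with a limiting ratio, because the
subproblems have sizes `rank (N i) x` and `N i - 1 - rank (N i) x`. Genericity keeps the time off
the pivots, where the limit of the toll is not available. -/
lemma tendsto_running (m : ℕ) {u : List Bool → ℝ} (hu : Inner u) {t : ℝ} (ht : 0 < t)
    (hg : Generic m u t) {N l : ℕ → ℕ} (hN : Tendsto N atTop atTop) (hlN : ∀ᶠ i in atTop, l i ≤ N i)
    (hl : Tendsto (fun i => (l i : ℝ) / N i) atTop (𝓝 t)) :
    Tendsto (fun i => running toll m u (N i) (l i) / N i) atTop (𝓝 (trunc m u t)) := by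
  induction m generalizing u t N l with
  | zero => simp [running, trunc]
  | succ m ih =>
    have hx := hu []
    set x := u [] with hxdef
    have hr := tendsto_rank_div hx hN
    have hrt := tendsto_atTop_of_ratio hN hr hx.1
    have hrN : ∀ᶠ i in atTop, rank (N i) x < N i := by
      filter_upwards [hN.eventually_gt_atTop 0] with i hi using rank_lt hi x
    have hl0 : ∀ᶠ i in atTop, 0 < l i :=
      (tendsto_atTop_of_ratio hN hl ht).eventually_gt_atTop 0
    have hN1 := hN.eventually_gt_atTop 1
    have hr0 := hrt.eventually_gt_atTop 0
    obtain ⟨hne, hlt, hgt⟩ := hg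
    rw [← hxdef] at hne hlt hgt
    rcases lt_or_gt_of_ne hne with h | h
    · have hlr : ∀ᶠ i in atTop, l i ≤ rank (N i) x := by
        filter_upwards [eventually_lt_of_ratio_lt hN hl hr h] with i hi
        omega
      have hl' : Tendsto (fun i => (l i : ℝ) / rank (N i) x) atTop (𝓝 (t / x)) := by
        refine (hl.div hr hx.1.ne').congr' ?_
        filter_upwards [hN1] with i hi
        have : (N i : ℝ) ≠ 0 := by exact_mod_cast (by omega : N i ≠ 0)
        rw [Pi.div_apply, div_div_div_cancel_right₀ this]
      have h1 := ih (hu.sub false) (div_pos ht hx.1) (hlt h) hrt hlr hl'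
      have h2 := (tendsto_toll_of_lt hN hrN hr hl ht h hx.2).add (hr.mul h1)
      rw [trunc, ← hxdef, if_pos h]
      refine h2.congr' ?_
      filter_upwards [hN1, hl0, hlr, hr0] with i i1 i2 i3 i4
      have h4 : (rank (N i) x : ℝ) ≠ 0 := by exact_mod_cast i4.ne'
      rw [running_succ _ u i1 i2, ← hxdef, if_pos i3, add_div]
      field_simp
    · have hlr : ∀ᶠ i in atTop, rank (N i) x + 1 < l i :=
        eventually_lt_of_ratio_lt hN hr hl h
      have h1x : 0 < 1 - x := sub_pos.2 hx.2
      have hc := tendsto_ratio_compl hN hrN hr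
      have hct := tendsto_atTop_of_ratio hN hc h1x
      have hc0 := hct.eventually_gt_atTop 0
      have hr1 : Tendsto (fun i => (rank (N i) x : ℝ) / rank (N i) x) atTop (𝓝 1) := by
        refine tendsto_const_nhds.congr' ?_
        filter_upwards [hr0] with i hi
        rw [_root_.div_self (by exact_mod_cast hi.ne')]
      have hl' : Tendsto (fun i => ((l i - (rank (N i) x + 1) : ℕ) : ℝ) /
          (N i - 1 - rank (N i) x : ℕ)) atTop (𝓝 ((t - x) / (1 - x))) := by
        have h0 : Tendsto (fun i => (1 : ℝ) / N i) atTop (𝓝 0) :=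
          (tendsto_const_div_atTop_nhds_zero_nat (1 : ℝ)).comp hN
        have h1 := ((hl.sub hr).sub h0).div hc h1x.ne'
        rw [sub_zero] at h1
        refine h1.congr' ?_
        filter_upwards [hN1, hlr] with i hi hi'
        have : (N i : ℝ) ≠ 0 := by exact_mod_cast (by omega : N i ≠ 0)
        rw [Pi.div_apply, Nat.cast_sub hi'.le, ← sub_div, ← sub_div, div_div_div_cancel_right₀ this]
        push_cast
        ring
      -- The left part is processed completely, which is time `1` for it.
      have h1 := ih (hu.sub false) one_pos (generic_one m (hu.sub _)) hrt
        (Eventually.of_forall fun i => le_rfl) hr1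
      have h2 := ih (hu.sub true) (div_pos (sub_pos.2 h) h1x) (hgt h) hct
        (by filter_upwards [hlN] with i hi; omega) hl'
      have h3 := (tendsto_toll_of_gt hN hrN hlN hr hl hx.1 h hx.2).add
        ((hr.mul h1).add (hc.mul h2))
      rw [trunc, ← hxdef, if_neg h.not_gt]
      refine h3.congr' ?_
      filter_upwards [hN1, hl0, hlr, hr0, hc0] with i i1 i2 i3 i4 i5
      have h4 : (rank (N i) x : ℝ) ≠ 0 := by exact_mod_cast i4.ne'
      have h5 : ((N i - 1 - rank (N i) x : ℕ) : ℝ) ≠ 0 := by exact_mod_cast i5.ne'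
      rw [running_succ _ u i1 i2, ← hxdef, if_neg (by omega), add_div]
      field_simp

/-! ## Uniform convergence of the partial sums -/

/-- A majorant for the square of the `m`-th increment of the partial sums, uniformly in time. -/
def majorant : ℕ → (List Bool → ℝ) → ℝ
  | 0, u => (15 + |total (sub false u) []|) ^ 2
  | m + 1, u => u [] ^ 2 * majorant m (sub false u) + (1 - u []) ^ 2 * majorant m (sub true u)

lemma majorant_nonneg (m : ℕ) (u : List Bool → ℝ) : 0 ≤ majorant m u := by
  induction m generalizing u with
  | zero => exact sq_nonneg _
  | succ m ih =>
    have := ih (sub false u)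
    have := ih (sub true u)
    unfold majorant
    positivity

lemma measurable_majorant (m : ℕ) : Measurable (majorant m) := by
  induction m with
  | zero =>
    have h : Measurable fun u => total (sub false u) [] :=
      measurable_total.comp (measurable_sub false)
    change Measurable fun u => (15 + |total (sub false u) []|) ^ 2
    fun_prop
  | succ m ih =>
    have h0 : Measurable fun u => majorant m (sub false u) := ih.comp (measurable_sub false)
    have h1 : Measurable fun u => majorant m (sub true u) := ih.comp (measurable_sub true)
    change Measurable fun u =>
      u [] ^ 2 * majorant m (sub false u) + (1 - u []) ^ 2 * majorant m (sub true u)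
    fun_prop

/-- At each time only one child contributes to the increment. Adding the bounds of both children
therefore covers all times at once, at no loss beyond the factor `x ^ 2 + (1 - x) ^ 2`. -/
lemma sq_increment_le (m : ℕ) {u : List Bool → ℝ} (hu : Inner u) {t : ℝ}
    (ht : t ∈ Set.Icc (0 : ℝ) 1) :
    (partialProcess u (m + 1) t - partialProcess u m t) ^ 2 ≤ majorant m u := by
  induction m generalizing u t with
  | zero =>
    rw [partialProcess_succ_of_inner hu, partialProcess_zero, partialProcess_zero,
      partialProcess_zero, mul_zero, mul_zero, add_zero, sub_zero, majorant]
    refine sq_le_sq' ?_ ?_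
    all_goals
      have h1 := abs_le.1 (abs_costAt_le ht ⟨(hu []).1.le, (hu []).2.le⟩)
      have h2 : |u [] * total (sub false u) []| ≤ |total (sub false u) []| := by
        rw [abs_mul, abs_of_pos (hu []).1]
        exact mul_le_of_le_one_left (abs_nonneg _) (hu []).2.le
      have h3 := abs_le.1 h2
      have h4 := abs_nonneg (total (sub false u) [])
      split_ifs <;> linarith
  | succ m ih =>
    rw [partialProcess_succ_of_inner hu (m + 1), partialProcess_succ_of_inner hu m, majorant]
    have h0 := majorant_nonneg m (sub false u)
    have h1 := majorant_nonneg m (sub true u)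
    split_ifs with h
    · have := mul_le_mul_of_nonneg_left (ih (hu.sub false) (hu.time_left ht h))
        (sq_nonneg (u []))
      have := mul_nonneg (sq_nonneg (1 - u [])) h1
      rw [add_sub_add_left_eq_sub, ← mul_sub, mul_pow]
      linarith
    · have := mul_le_mul_of_nonneg_left (ih (hu.sub true) (hu.time_right ht h))
        (sq_nonneg (1 - u []))
      have := mul_nonneg (sq_nonneg (u [])) h0
      -- The toll and the term with `Q` of the left subtree occur in both partial sums and cancel.
      rw [add_sub_add_left_eq_sub, add_sub_add_left_eq_sub, ← mul_sub, mul_pow]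
      linarith

lemma lintegral_majorant_succ (m : ℕ) :
    ∫⁻ u, ENNReal.ofReal (majorant (m + 1) u) ∂treeLaw
      = ENNReal.ofReal (2 / 3) * ∫⁻ u, ENNReal.ofReal (majorant m u) ∂treeLaw := by
  have hm : Measurable fun u => ENNReal.ofReal (majorant m u) :=
    (measurable_majorant m).ennreal_ofReal
  have hx : Measurable fun x : ℝ => ENNReal.ofReal (x ^ 2) := by fun_prop
  have hy : Measurable fun x : ℝ => ENNReal.ofReal ((1 - x) ^ 2) := by fun_prop
  have ex : ∫⁻ x, ENNReal.ofReal (x ^ 2) ∂unif = ENNReal.ofReal (1 / 3) := by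
    rw [← integral_unif_id_sq, ofReal_integral_eq_lintegral_ofReal
      ((continuous_pow 2).continuousOn.integrableOn_compact isCompact_Icc)
      (ae_of_all _ fun x => sq_nonneg x)]
  have ey : ∫⁻ x, ENNReal.ofReal ((1 - x) ^ 2) ∂unif = ENNReal.ofReal (1 / 3) := by
    rw [← integral_unif_one_sub_sq, ofReal_integral_eq_lintegral_ofReal
      ((by fun_prop : Continuous fun x : ℝ => (1 - x) ^ 2).continuousOn.integrableOn_compact
        isCompact_Icc) (ae_of_all _ fun x => sq_nonneg (1 - x))]
  have hsplit : ∀ u, ENNReal.ofReal (majorant (m + 1) u) =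
      (fun p : ℝ × (List Bool → ℝ) × (List Bool → ℝ) =>
        ENNReal.ofReal (p.1 ^ 2) * ENNReal.ofReal (majorant m p.2.1) +
        ENNReal.ofReal ((1 - p.1) ^ 2) * ENNReal.ofReal (majorant m p.2.2)) (split u) := by
    intro u
    have h0 := majorant_nonneg m (sub false u)
    have h1 := majorant_nonneg m (sub true u)
    simp only [split]
    rw [majorant, ENNReal.ofReal_add (by positivity) (by positivity),
      ENNReal.ofReal_mul (by positivity), ENNReal.ofReal_mul (by positivity)]
  have hm1 : Measurable fun p : ℝ × (List Bool → ℝ) × (List Bool → ℝ) =>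
      ENNReal.ofReal (p.1 ^ 2) * ENNReal.ofReal (majorant m p.2.1) :=
    (hx.comp measurable_fst).mul (hm.comp (measurable_fst.comp measurable_snd))
  have hm2 : Measurable fun p : ℝ × (List Bool → ℝ) × (List Bool → ℝ) =>
      ENNReal.ofReal ((1 - p.1) ^ 2) * ENNReal.ofReal (majorant m p.2.2) :=
    (hy.comp measurable_fst).mul (hm.comp (measurable_snd.comp measurable_snd))
  refine (lintegral_congr hsplit).trans ((measurePreserving_split.lintegral_comp
    (hm1.add hm2)).trans ((lintegral_add_left hm1 _).trans ?_))
  rw [lintegral_prod_mul (f := fun x : ℝ => ENNReal.ofReal (x ^ 2))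
      (g := fun p : (List Bool → ℝ) × (List Bool → ℝ) => ENNReal.ofReal (majorant m p.1))
      hx.aemeasurable (hm.comp measurable_fst).aemeasurable,
    lintegral_prod_mul (f := fun x : ℝ => ENNReal.ofReal ((1 - x) ^ 2))
      (g := fun p : (List Bool → ℝ) × (List Bool → ℝ) => ENNReal.ofReal (majorant m p.2))
      hy.aemeasurable (hm.comp measurable_snd).aemeasurable,
    (measurePreserving_fst (μ := treeLaw) (ν := treeLaw)).lintegral_comp hm,
    (measurePreserving_snd (μ := treeLaw) (ν := treeLaw)).lintegral_comp hm, ex, ey, ← add_mul,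
    ← ENNReal.ofReal_add (by norm_num) (by norm_num)]
  norm_num

lemma lintegral_majorant (m : ℕ) :
    ∫⁻ u, ENNReal.ofReal (majorant m u) ∂treeLaw
      = ENNReal.ofReal (2 / 3) ^ m * ∫⁻ u, ENNReal.ofReal (majorant 0 u) ∂treeLaw := by
  induction m with
  | zero => simp
  | succ m ih => rw [lintegral_majorant_succ, ih, pow_succ]; ring

lemma memLp_total : MemLp (fun u => total u []) 2 treeLaw := by
  simpa [partialTotal_zero] using (centered_total_sub 0).memLp

lemma lintegral_majorant_zero_ne_top :
    ∫⁻ u, ENNReal.ofReal (majorant 0 u) ∂treeLaw ≠ ⊤ := by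
  have h : MemLp (fun u => 15 + |total (sub false u) []|) 2 treeLaw :=
    (memLp_const (15 : ℝ)).add
      (memLp_total.comp_measurePreserving (measurePreserving_sub false)).norm
  simp only [majorant]
  exact h.integrable_sq.lintegral_lt_top.ne

/-- The weight `6 / 5` exceeds `1`, yet `6 / 5 * (2 / 3) = 4 / 5 < 1`, so the expected sum is
finite. -/
lemma ae_summable_majorant :
    ∀ᵐ u ∂treeLaw, Summable fun m => (6 / 5 : ℝ) ^ m * majorant m u := by
  have hm : ∀ m, Measurable fun u => ENNReal.ofReal ((6 / 5 : ℝ) ^ m * majorant m u) := fun m =>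
    ((measurable_majorant m).const_mul _).ennreal_ofReal
  have h : ∫⁻ u, ∑' m, ENNReal.ofReal ((6 / 5 : ℝ) ^ m * majorant m u) ∂treeLaw ≠ ⊤ := by
    rw [lintegral_tsum fun m => (hm m).aemeasurable]
    have e : ∀ m : ℕ, ∫⁻ u, ENNReal.ofReal ((6 / 5 : ℝ) ^ m * majorant m u) ∂treeLaw
        = ENNReal.ofReal ((4 / 5) ^ m) * ∫⁻ u, ENNReal.ofReal (majorant 0 u) ∂treeLaw := by
      intro m
      simp only [ENNReal.ofReal_mul (by positivity : (0 : ℝ) ≤ (6 / 5) ^ m)]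
      rw [lintegral_const_mul _ (measurable_majorant m).ennreal_ofReal, lintegral_majorant,
        ← mul_assoc, ← ENNReal.ofReal_pow (by norm_num), ← ENNReal.ofReal_mul (by positivity),
        ← mul_pow]
      norm_num
    simp only [e]
    rw [ENNReal.tsum_mul_right]
    exact ENNReal.mul_ne_top
      (summable_geometric_of_lt_one (by norm_num) (by norm_num)).tsum_ofReal_ne_top
      lintegral_majorant_zero_ne_top
  filter_upwards [ae_lt_top' (Measurable.tsum hm).aemeasurable h] with u hu
  have := ENNReal.summable_toReal hu.ne
  refine this.congr fun m => ?_
  rw [ENNReal.toReal_ofReal (mul_nonneg (by positivity) (majorant_nonneg m u))]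

/-- Almost surely, the partial sums converge uniformly to the Quicksort process. -/
lemma ae_tendstoUniformlyOn : ∀ᵐ u ∂treeLaw,
    TendstoUniformlyOn (fun m t => partialProcess u m t) (fun t => process u t) atTop
      (Set.Icc 0 1) := by
  filter_upwards [ae_inner, ae_summable_majorant] with u hu hs
  have hsum : Summable fun m => ((5 / 6 : ℝ) ^ m + (6 / 5 : ℝ) ^ m * majorant m u) / 2 :=
    ((summable_geometric_of_lt_one (by norm_num) (by norm_num)).add hs).div_const 2
  have hbd : ∀ m : ℕ, ∀ t ∈ Set.Icc (0 : ℝ) 1,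
      ‖(partialProcess u (m + 1) t - partialProcess u m t)‖
        ≤ ((5 / 6 : ℝ) ^ m + (6 / 5 : ℝ) ^ m * majorant m u) / 2 := by
    intro m t ht
    have h1 := sq_increment_le m hu ht
    rw [← sq_abs] at h1
    set y := |(partialProcess u (m + 1) t - partialProcess u m t)|
    have ha : (0 : ℝ) < (6 / 5) ^ m := by positivity
    have hab : (5 / 6 : ℝ) ^ m * (6 / 5) ^ m = 1 := by
      rw [← mul_pow]
      norm_num
    have h2 := mul_le_mul_of_nonneg_left h1 ha.le
    -- The inequality `2 y ≤ a⁻¹ + a y ^ 2` with `a = (6 / 5) ^ m` passes from summable weighted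
    -- squares to summable increments.
    have h3 : 0 ≤ (5 / 6 : ℝ) ^ m * (1 - (6 / 5) ^ m * y) ^ 2 := by positivity
    have h4 : (5 / 6 : ℝ) ^ m * (1 - (6 / 5) ^ m * y) ^ 2
        = (5 / 6 : ℝ) ^ m - 2 * y + (6 / 5) ^ m * y ^ 2 := by
      linear_combination (-2 * y + (6 / 5) ^ m * y ^ 2) * hab
    rw [Real.norm_eq_abs]
    change y ≤ _
    linarith
  have h := tendstoUniformlyOn_tsum_nat hsum hbd
  have hR : ∀ (m : ℕ) (t : ℝ), ∑ i ∈ Finset.range m,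
      (partialProcess u (i + 1) t - partialProcess u i t) = partialProcess u m t := by
    intro m t
    rw [Finset.sum_range_sub fun i => partialProcess u i t, partialProcess_zero, sub_zero]
  simp only [hR] at h
  refine h.congr_right fun t ht => ?_
  exact ((h.tendsto_at ht).limUnder_eq).symm

end QuicksortProcess

end

noncomputable section

namespace QuicksortProcess

/-! ## Convergence in probability -/

section InMeasure

variable {α : Type*} [MeasurableSpace α] {μ : Measure α}

lemma measure_le_abs_sub_le (f g h : α → ℝ) (a b : ℝ) :
    μ {x | a + b ≤ |f x - h x|} ≤ μ {x | a ≤ |f x - g x|} + μ {x | b ≤ |g x - h x|} := by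
  refine (measure_mono fun x hx => ?_).trans (measure_union_le _ _)
  by_contra hcon
  simp only [Set.mem_union, Set.mem_ofPred_eq, not_or, not_le] at hcon hx
  have := abs_sub_le (f x) (g x) (h x)
  linarith

/-- Convergence in measure of a sequence with good approximations which converge. -/
lemma tendstoInMeasure_of_approx {f : ℕ → α → ℝ} {g : α → ℝ} {f' : ℕ → ℕ → α → ℝ}
    {g' : ℕ → α → ℝ} (h1 : ∀ m, TendstoInMeasure μ (f' m) atTop (g' m))
    (h2 : TendstoInMeasure μ g' atTop g)
    (h3 : ∀ ε > 0, ∃ a : ℕ → ENNReal, Tendsto a atTop (𝓝 0) ∧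
      ∀ m, ∀ᶠ n in atTop, μ {x | ε ≤ |f n x - f' m n x|} ≤ a m) :
    TendstoInMeasure μ f atTop g := by
  rw [tendstoInMeasure_iff_norm] at h2 ⊢
  simp only [tendstoInMeasure_iff_norm] at h1
  intro ε hε
  simp only [Real.norm_eq_abs] at *
  obtain ⟨a, ha, hfa⟩ := h3 (ε / 3) (by positivity)
  refine ENNReal.tendsto_nhds_zero.2 fun δ hδ => ?_
  have hδ3 : 0 < δ / 3 := ENNReal.div_pos hδ.ne' (by norm_num)
  obtain ⟨m, hm1, hm2⟩ := ((ENNReal.tendsto_nhds_zero.1 ha _ hδ3).and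
    (ENNReal.tendsto_nhds_zero.1 (h2 (ε / 3) (by positivity)) _ hδ3)).exists
  filter_upwards [hfa m, ENNReal.tendsto_nhds_zero.1 (h1 m (ε / 3) (by positivity)) _ hδ3]
    with n hn1 hn2
  have e1 := measure_le_abs_sub_le (μ := μ) (f n) (f' m n) g (ε / 3) (ε / 3 + ε / 3)
  have e2 := measure_le_abs_sub_le (μ := μ) (f' m n) (g' m) g (ε / 3) (ε / 3)
  rw [show ε / 3 + (ε / 3 + ε / 3) = ε by ring] at e1
  calc μ {x | ε ≤ |f n x - g x|} ≤ δ / 3 + (δ / 3 + δ / 3) :=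
        e1.trans (add_le_add (hn1.trans hm1) (e2.trans (add_le_add hn2 hm2)))
    _ = δ := by rw [← add_assoc, ENNReal.add_thirds]

lemma tendstoInMeasure_pi {ι : Type*} [Fintype ι] {f : ℕ → α → ι → ℝ} {g : α → ι → ℝ}
    (h : ∀ i, TendstoInMeasure μ (fun n x => f n x i) atTop fun x => g x i) :
    TendstoInMeasure μ f atTop g := by
  intro ε hε
  have h0 : Tendsto (fun n => ∑ i, μ {x | ε ≤ edist (f n x i) (g x i)}) atTop (𝓝 0) := by
    simpa using tendsto_finsetSum Finset.univ fun i _ => h i ε hε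
  refine tendsto_of_tendsto_of_tendsto_of_le_of_le tendsto_const_nhds h0 (fun n => zero_le)
    fun n => ?_
  refine (measure_mono fun x hx => ?_).trans (measure_iUnion_fintype_le μ _)
  rw [Set.mem_iUnion]
  by_contra hcon
  push Not at hcon
  refine (not_lt.2 hx) ((Finset.sup_lt_iff hε).2 fun i _ => ?_)
  exact not_le.1 (hcon i)

end InMeasure

/-! ### Convergence of the coupled running times -/

lemma tendsto_rate (K ε : ℝ) :
    Tendsto (fun m : ℕ => ENNReal.ofReal (K * (2 / 3) ^ m / ε ^ 2)) atTop (𝓝 0) := by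
  rw [← ENNReal.ofReal_zero]
  refine ENNReal.tendsto_ofReal ?_
  simpa using ((tendsto_pow_atTop_nhds_zero_of_lt_one (by norm_num : (0 : ℝ) ≤ 2 / 3)
      (by norm_num)).const_mul K).div_const (ε ^ 2)

lemma measurable_trunc_at (m : ℕ) (t : ℝ) : Measurable fun u => trunc m u t :=
  (measurable_trunc m).comp (f := fun u : List Bool → ℝ => (u, t)) (by fun_prop)

lemma measurable_truncError_at (m : ℕ) (t : ℝ) : Measurable fun u => truncError m u t :=
  (measurable_truncError m).comp (f := fun u : List Bool → ℝ => (u, t)) (by fun_prop)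

/-- The partial sums converge almost surely, and `truncError` is removed by Chebyshev's inequality.
-/
lemma tendstoInMeasure_trunc {t : ℝ} (ht : t ∈ Set.Icc (0 : ℝ) 1) :
    TendstoInMeasure treeLaw (fun m u => trunc m u t) atTop fun u => process u t := by
  have h1 : TendstoInMeasure treeLaw (fun m u => trunc m u t + truncError m u t) atTop
      fun u => process u t := by
    refine tendstoInMeasure_of_tendsto_ae (fun m =>
      ((measurable_trunc_at m t).add (measurable_truncError_at m t)).aestronglyMeasurable) ?_
    filter_upwards [ae_inner, ae_tendstoUniformlyOn] with u hu h
    simpa only [partialProcess_eq _ hu] using h.tendsto_at ht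
  rw [tendstoInMeasure_iff_norm] at h1 ⊢
  intro ε hε
  simp only [Real.norm_eq_abs] at *
  have h2 := (tendsto_rate 75 (ε / 2)).add (h1 (ε / 2) (by positivity))
  rw [add_zero] at h2
  refine tendsto_of_tendsto_of_tendsto_of_le_of_le tendsto_const_nhds h2 (fun n => zero_le)
    fun m => ?_
  have e := measure_le_abs_sub_le (μ := treeLaw) (fun u => trunc m u t)
    (fun u => trunc m u t + truncError m u t) (fun u => process u t) (ε / 2) (ε / 2)
  rw [add_halves] at e
  refine e.trans (add_le_add_left ?_ _)
  simp only [sub_add_cancel_left, abs_neg]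
  exact (centered_truncError m t).measure_ge_le (by positivity)

lemma floor_le_self {t : ℝ} (ht : t ≤ 1) (n : ℕ) : ⌊(n : ℝ) * t⌋₊ ≤ n :=
  Nat.floor_le_of_le (mul_le_of_le_one_right (Nat.cast_nonneg n) ht)

lemma tendsto_floor_div {t : ℝ} (ht : 0 ≤ t) :
    Tendsto (fun n : ℕ => (⌊(n : ℝ) * t⌋₊ : ℝ) / n) atTop (𝓝 t) := by
  simpa only [mul_comm, Function.comp_def] using
    (tendsto_nat_floor_mul_div_atTop ht).comp tendsto_natCast_atTop_atTop

/-- The normalised running times of the coupled algorithm converge in probability. -/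
lemma tendstoInMeasure_running {t : ℝ} (ht : t ∈ Set.Ioc (0 : ℝ) 1) :
    TendstoInMeasure treeLaw (fun n u => running toll n u n ⌊(n : ℝ) * t⌋₊ / n) atTop
      fun u => process u t := by
  refine tendstoInMeasure_of_approx (f' := fun m n u => running toll m u n ⌊(n : ℝ) * t⌋₊ / n)
    (g' := fun m u => trunc m u t) (fun m => ?_) (tendstoInMeasure_trunc ⟨ht.1.le, ht.2⟩)
    fun ε hε => ⟨_, tendsto_rate 2700 ε, fun m => ?_⟩
  · refine tendstoInMeasure_of_tendsto_ae (fun n =>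
      ((measurable_running toll m n _).div_const _).aestronglyMeasurable) ?_
    filter_upwards [ae_inner, ae_generic m t] with u hu hg
    exact tendsto_running m hu ht.1 hg tendsto_id
      (Eventually.of_forall fun n => floor_le_self ht.2 n) (tendsto_floor_div ht.1.le)
  -- Depth `n` is the full recursion, so the error is that of cutting at depth `m` with `n - m`
  -- further generations; division by `n` makes the bound independent of `n`.
  · filter_upwards [eventually_ge_atTop (m + 1)] with n hn
    have hn0 : (n : ℝ) ≠ 0 := by exact_mod_cast (by omega : n ≠ 0)
    have h := ((centered_running_sub m (n - m) (floor_le_self ht.2 n)).const_mul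
      (1 / n)).measure_ge_le hε
    rw [Nat.add_sub_cancel' (by omega),
      show (1 / (n : ℝ)) ^ 2 * (2700 * (2 / 3) ^ m * n ^ 2) = 2700 * (2 / 3) ^ m by
        field_simp] at h
    refine le_of_eq_of_le ?_ h
    congr 1
    ext u
    rw [Set.mem_ofPred_eq, Set.mem_ofPred_eq, ← sub_div, div_eq_inv_mul, one_div]

/-- Because all times live on one tree, coordinatewise convergence in probability is already joint
convergence. -/
lemma tendstoInDistribution_running {k : ℕ} {t : Fin k → ℝ}
    (ht : ∀ i, t i ∈ Set.Ioc (0 : ℝ) 1) :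
    TendstoInDistribution
      (fun n (u : List Bool → ℝ) i => running toll n u n ⌊(n : ℝ) * t i⌋₊ / n) atTop
      (fun u i => process u (t i)) (fun _ => treeLaw) treeLaw :=
  (tendstoInMeasure_pi fun i => tendstoInMeasure_running (ht i)).tendstoInDistribution
    fun n => (measurable_pi_lambda _ fun _ =>
      (measurable_running toll n n _).div_const _).aemeasurable

/-- The normalised running times have the law of those of the coupled algorithm. -/
lemma map_normalizedRunningTime {Ω : Type*} [MeasurableSpace Ω] {P : Measure Ω} {S : Finset ℝ}
    {n : ℕ} (hS : S.card = n) {X : Ω → ℕ → ℕ} (hX : HasLaw X (runningTimeLaw S).toMeasure P)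
    {k : ℕ} {t : Fin k → ℝ} (ht : ∀ i, t i ∈ Set.Ioc (0 : ℝ) 1) :
    AEMeasurable (fun ω i => normalizedRunningTime P X n (t i) ω) P ∧
      P.map (fun ω i => normalizedRunningTime P X n (t i) ω)
        = treeLaw.map fun u i => running toll n u n ⌊(n : ℝ) * t i⌋₊ / n := by
  set V : (List Bool → ℝ) → ℕ → ℕ := fun u l => if l ≤ n then comparisons u n l else 0 with hV
  have hVm : Measurable V := by
    refine measurable_pi_lambda _ fun l => ?_
    simp only [hV]
    split_ifs
    · fun_prop
    · exact measurable_const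
  have hmap : P.map X = treeLaw.map V := by
    rw [hX.map_eq, runningTimeLaw_toMeasure, hS]
  have hmean : ∀ i, ∫ ω, (X ω ⌊(n : ℝ) * t i⌋₊ : ℝ) ∂P = meanCost n ⌊(n : ℝ) * t i⌋₊ := by
    intro i
    have hl := floor_le_self (ht i).2 n
    have hm : Measurable fun x : ℕ → ℕ => (x ⌊(n : ℝ) * t i⌋₊ : ℝ) := by fun_prop
    rw [← integral_map (f := fun x : ℕ → ℕ => (x ⌊(n : ℝ) * t i⌋₊ : ℝ)) hX.aemeasurable
      hm.aestronglyMeasurable, hmap, integral_map hVm.aemeasurable hm.aestronglyMeasurable,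
      ← integral_comparisons hl]
    simp only [hV, if_pos hl]
  set Φ : (ℕ → ℕ) → Fin k → ℝ := fun x i =>
    ((x ⌊(n : ℝ) * t i⌋₊ : ℝ) - meanCost n ⌊(n : ℝ) * t i⌋₊) / n with hΦ
  have hΦm : Measurable Φ := by
    refine measurable_pi_lambda _ fun i => ?_
    simp only [hΦ]
    fun_prop
  have h1 : (fun ω i => normalizedRunningTime P X n (t i) ω) = Φ ∘ X := by
    funext ω i
    simp only [normalizedRunningTime, hmean i, hΦ, Function.comp]
  have h2 : (fun (u : List Bool → ℝ) (i : Fin k) => running toll n u n ⌊(n : ℝ) * t i⌋₊ / n)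
      = Φ ∘ V := by
    funext u i
    have hl := floor_le_self (ht i).2 n
    simp only [hΦ, hV, Function.comp, running_toll_eq u hl, if_pos hl]
  rw [h1, h2]
  refine ⟨hΦm.comp_aemeasurable hX.aemeasurable, ?_⟩
  rw [← AEMeasurable.map_map_of_aemeasurable hΦm.aemeasurable hX.aemeasurable, hmap,
    Measure.map_map hΦm hVm]

end QuicksortProcess

end

/-! ### Transfer to the given probability spaces -/

theorem theorem1p2
    -- the independent uniform random variables `U v` on the vertices of the binary tree
    {Ω : Type*} [MeasurableSpace Ω] (P : Measure Ω) [IsProbabilityMeasure P]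
    (U : List Bool → Ω → ℝ) (hU : iIndepFun U P)
    (hUlaw : ∀ v, HasLaw (U v) (volume.restrict (Set.Icc (0 : ℝ) 1)) P)
    -- the inputs, one of each size, and the running times on them
    (S : ℕ → Finset ℝ) (hS : ∀ n, (S n).card = n)
    {Ω' : ℕ → Type*} [∀ n, MeasurableSpace (Ω' n)]
    (P' : (n : ℕ) → Measure (Ω' n)) [∀ n, IsProbabilityMeasure (P' n)]
    (X : (n : ℕ) → Ω' n → ℕ → ℕ)
    (hX : ∀ n, HasLaw (X n) (runningTimeLaw (S n)).toMeasure (P' n)) :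
    -- the limits that define the Quicksort process exist almost surely
    (∀ᵐ ω ∂P,
      (∀ v, Tendsto (fun m => QuicksortProcess.partialTotal (fun w => U w ω) m v) atTop
        (𝓝 (QuicksortProcess.total (fun w => U w ω) v))) ∧
      TendstoUniformlyOn (fun m t => QuicksortProcess.partialProcess (fun w => U w ω) m t)
        (fun t => QuicksortProcess.process (fun w => U w ω) t) atTop (Set.Icc 0 1)) ∧
    -- convergence of the finite dimensional distributions on `(0, 1]`
    ∀ (k : ℕ) (t : Fin k → ℝ), (∀ i, t i ∈ Set.Ioc (0 : ℝ) 1) →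
      TendstoInDistribution
        (fun n ω i => normalizedRunningTime (P' n) (X n) n (t i) ω) atTop
        (fun ω i => QuicksortProcess.process (fun w => U w ω) (t i)) P' P := by
  have hUm : AEMeasurable (fun ω w => U w ω) P :=
    aemeasurable_pi_iff.2 fun v => (hUlaw v).aemeasurable
  -- Independence and the uniform marginals determine the joint law, so almost sure statements about
  -- trees carry over to `P`.
  have hmap : P.map (fun ω w => U w ω) = QuicksortProcess.treeLaw := by
    rw [hU.map_fun_eq_infinitePi_map₀ hUm]
    congr 1
    funext v
    exact (hUlaw v).map_eq
  refine ⟨?_, fun k t ht => ?_⟩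
  · have h1 : ∀ᵐ u ∂(QuicksortProcess.treeLaw), ∀ v,
        Tendsto (fun m => QuicksortProcess.partialTotal u m v) atTop (𝓝 (QuicksortProcess.total u v)) := by
      refine ae_all_iff.2 fun v => ?_
      filter_upwards [(QuicksortProcess.measurePreserving_subtree v).quasiMeasurePreserving.ae QuicksortProcess.ae_tendsto_total]
        with u hu
      rw [QuicksortProcess.total_subtree u v]
      simpa only [QuicksortProcess.partialTotal_subtree u _ v] using hu
    have h2 := h1.and QuicksortProcess.ae_tendstoUniformlyOn
    rw [← hmap] at h2
    exact ae_of_ae_map hUm h2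
  · have h := QuicksortProcess.tendstoInDistribution_running ht
    have hlim : AEMeasurable (fun (u : List Bool → ℝ) (i : Fin k) => QuicksortProcess.process u (t i))
        (P.map fun ω w => U w ω) := hmap ▸ h.aemeasurable_limit
    have hn := fun n => QuicksortProcess.map_normalizedRunningTime (hS n) (hX n) ht
    refine ⟨fun n => (hn n).1, hlim.comp_aemeasurable hUm, ?_⟩
    -- Convergence in distribution concerns only the laws, and both the sequence and the limit have
    -- the laws of the coupling.
    refine (h.tendsto.congr fun n => Subtype.ext (hn n).2.symm).trans
      (le_of_eq (congrArg 𝓝 (Subtype.ext ?_)))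
    exact (congrArg (fun μ => μ.map fun u i => QuicksortProcess.process u (t i)) hmap.symm).trans
      (AEMeasurable.map_map_of_aemeasurable hlim hUm)
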